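/- Let $P_0,P_1$ be probability measures on a measurable space $\mathcal X$, let $\Theta$ be a nonempty compact parameter space and, for each $\theta\in\Theta$, let $\mathsf q_\theta:\mathcal X\to\mathcal K=\{1,\dots,K\}$ be a measurable quantizer; $Q_{i,\theta}$ is the law of $\mathsf q_\theta(X)$ for $X\sim P_i$. Let $\kappa\in[0,1]$ and $\lambda_0,\lambda_1>0$. Under $\mathcal H_i$ the raw data $X_1,X_2,\dots$ are i.i.d. with law $P_i$. A sequential test consists of quantization rules $\eta_n:\mathcal K^n\to\Theta$, stopping rules $\psi_n:\mathcal K^n\to[0,1]$ and decision rules $\delta_n:\mathcal K^n\to[0,1]$, $n\ge 0$. It observes $Y_{n+1}=\mathsf q_{\theta_n}(X_{n+1})$ with $\theta_n=\eta_n(Y_1,\dots,Y_n)$; $\tau\in\{0,1,\dots,\infty\}$ is the first $n$ at which an independent Bernoulli experiment with success probability $\psi_n(Y_1,\dots,Y_n)$ succeeds, and $\delta_\tau$ is the probability of then deciding for $\mathcal H_1$. With $\mathbb Q_{i,\eta}$ the law of $(Y_n)$ under $\mathcal H_i$ and $\mathbb Q_{\kappa,\eta}=(1-\kappa)\mathbb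 Q_{0,\eta}+\kappa\,\mathbb Q_{1,\eta}$, its cost is $$J(\eta,\delta,\psi)=E_{\mathbb Q_{\kappa,\eta}}[\tau]+\lambda_0E_{\mathbb Q_{0,\eta}}[\delta_\tau;\tau<\infty]+\lambda_1E_{\mathbb Q_{1,\eta}}[1-\delta_\tau;\tau<\infty]\in[0,\infty],$$ and $J^*=\inf_{\eta,\delta,\psi}J(\eta,\delta,\psi)$. Then the following holds. (1) The functional equation $$\rho(z)=\min\Bigl\{\lambda_0,\;z\lambda_1,\;(1-\kappa)+\kappa z+\inf_{\theta\in\Theta}D_\rho(z;\theta)\Bigr\},\qquad D_\rho(z;\theta)=\sum_{k:\,Q_{0,\theta}(k)>0}\rho\Bigl(z\,\frac{Q_{1,\theta}(k)}{Q_{0,\theta}(k)}\Bigr)Q_{0,\theta}(k),\quad z\ge0,$$ has exactly one solution $\rho:[0,\infty)\to[0,\infty)$. (2) $J^*=\rho(1)$. (3) If $\theta\mapsto Q_{0,\theta}(k)$ and $\theta\mapsto Q_{1,\theta}(k)$ are continuous for every $k$, then the infimum over $\theta$ in (1) is attained for every $z\ge 0$, so there is a selector as in (4). (4) There are thresholds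 $A\in(0,\infty]$ and $B\in[0,\infty)$, $B\le A$, depending only on $\mathcal X,P_0,P_1,\Theta,(\mathsf q_\theta),\kappa,\lambda_0,\lambda_1$, with $A<\infty$ if $\kappa>0$ or $P_0\ll P_1$, and $B>0$ if $\kappa<1$ or $P_1\ll P_0$, such that the following holds for every $\eta^*:[0,\infty)\to\Theta$ with $D_\rho(z;\eta^*(z))=\min_{\theta\in\Theta}D_\rho(z;\theta)$ for all $z\ge0$. Given quantization rules $\eta$, let $z_0=1$ and $z_{n+1}=z_n\,Q_{1,\theta_n}(Y_{n+1})/Q_{0,\theta_n}(Y_{n+1})\in[0,\infty]$ with $\theta_n=\eta_n(Y_1,\dots,Y_n)$, where $c/0=\infty$ for $c>0$ and $0/0=0\cdot\infty=0$. There are quantization rules $\eta$ with $\theta_n=\eta^*(z_n)$ for all $n\ge0$ whenever $z_n<\infty$, and every such $\eta$ is optimal: together with the test that at each time $n\ge 0$ stops and decides for $\mathcal H_1$ if $z_n\ge A$, stops and decides for $\mathcal H_0$ if $z_n\le B$ (and $z_n<A$), and continues otherwise, it has cost $J^*$. If $A<\infty$ and $B>0$, this test stops almost surely under both hypotheses.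 -/

import Mathlib

open MeasureTheory
open scoped NNReal ENNReal

namespace QuantizedTest

noncomputable section

/- Throughout, `𝒳` is the space of raw observations, `Fin K` is the alphabet of the quantized
observations and `q θ : 𝒳 → Fin K` is the quantizer with parameter `θ : Θ`.
Sequences are indexed from `0`: `x n` is the raw observation `X_{n+1}` and `y n` is the
quantized observation `Y_{n+1}`. A history of length `n` is a function `Fin n → Fin K`. -/

/-- The probability `Q_θ(k)` of the quantizer output `k` when the raw observation has law `P`. -/
def outProb {𝒳 Θ : Type*} [MeasurableSpace 𝒳] {K : ℕ}
    (P : Measure 𝒳) (q : Θ → 𝒳 → Fin K) (θ : Θ) (k : Fin K) : ℝ≥0 :=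
  ((P.map (q θ)) {k}).toNNReal

/-! ### Sequential tests -/

/-- Sequences of quantization rules: `η n` maps the first `n` quantized observations to the
parameter used for quantizing the next raw observation. -/
abbrev QuantRule (K : ℕ) (Θ : Type*) : Type _ := (n : ℕ) → (Fin n → Fin K) → Θ

/-- Sequences of randomized stopping rules, or of randomized decision rules: `ψ n` and `δ n` map
the first `n` quantized observations to a probability. -/
abbrev TestRule (K : ℕ) : Type := (n : ℕ) → (Fin n → Fin K) → unitInterval

/-- The first `n` quantized observations. -/
def hist {K : ℕ} (y : ℕ → Fin K) (n : ℕ) : Fin n → Fin K := fun i => y i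

/-- The sequence of quantized observations that the quantization rules `η` produce from the raw
sequence `x`. -/
def quantize {𝒳 Θ : Type*} {K : ℕ} (q : Θ → 𝒳 → Fin K) (η : QuantRule K Θ) (x : ℕ → 𝒳) :
    ℕ → Fin K
  | n => q (η n (fun i : Fin n => quantize q η x i)) (x n)
decreasing_by exact i.2

/-- The joint law of the quantized observations under the quantization rules `η` when the raw
observations are i.i.d. with law `P`. -/
def obsLaw {𝒳 Θ : Type*} [MeasurableSpace 𝒳] {K : ℕ}
    (P : Measure 𝒳) [IsProbabilityMeasure P] (q : Θ → 𝒳 → Fin K) (η : QuantRule K Θ) :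
    Measure (ℕ → Fin K) :=
  (Measure.infinitePi (fun _ : ℕ => P)).map (quantize q η)

/-- The mixture of the two joint laws, with weight `κ` on the second one. -/
def mixLaw {𝒳 Θ : Type*} [MeasurableSpace 𝒳] {K : ℕ}
    (P₀ P₁ : Measure 𝒳) [IsProbabilityMeasure P₀] [IsProbabilityMeasure P₁]
    (q : Θ → 𝒳 → Fin K) (κ : ℝ) (η : QuantRule K Θ) : Measure (ℕ → Fin K) :=
  ENNReal.ofReal (1 - κ) • obsLaw P₀ q η + ENNReal.ofReal κ • obsLaw P₁ q η

/-- A run of a test: the quantized observations together with independent uniform variables that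
drive the Bernoulli experiments of the randomized stopping rule. -/
abbrev Run (K : ℕ) : Type := (ℕ → Fin K) × (ℕ → unitInterval)

/-- The law of a run when the quantized observations have law `Q`. -/
def runLaw {K : ℕ} (Q : Measure (ℕ → Fin K)) : Measure (Run K) :=
  Q.prod (Measure.infinitePi (fun _ : ℕ => (volume : Measure unitInterval)))

/-- The stopping time `τ`: the first `n` at which the Bernoulli experiment with success probability
`ψ n (Y₁, …, Yₙ)` succeeds, and `⊤` if there is none. -/
def stopTime {K : ℕ} (ψ : TestRule K) (ω : Run K) : ℕ∞ :=
  ⨅ (n : ℕ) (_ : ω.2 n ≤ ψ n (hist ω.1 n)), (n : ℕ∞)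

/-- The probability `δ_τ` of accepting `H₁` at the stopping time. A test that never stops makes no
decision, hence no error. -/
def acceptOne {K : ℕ} (ψ δ : TestRule K) (ω : Run K) : ℝ≥0∞ :=
  if stopTime ψ ω = ⊤ then 0
  else ENNReal.ofReal (δ (stopTime ψ ω).toNat (hist ω.1 (stopTime ψ ω).toNat))

/-- The probability `1 - δ_τ` of accepting `H₀` at the stopping time. -/
def acceptZero {K : ℕ} (ψ δ : TestRule K) (ω : Run K) : ℝ≥0∞ :=
  if stopTime ψ ω = ⊤ then 0
  else ENNReal.ofReal (1 - δ (stopTime ψ ω).toNat (hist ω.1 (stopTime ψ ω).toNat))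

/-- The weighted cost `E_κ[τ] + λ₀ E₀[δ_τ] + λ₁ E₁[1 - δ_τ]`. -/
def cost {𝒳 Θ : Type*} [MeasurableSpace 𝒳] {K : ℕ}
    (P₀ P₁ : Measure 𝒳) [IsProbabilityMeasure P₀] [IsProbabilityMeasure P₁]
    (q : Θ → 𝒳 → Fin K) (κ l₀ l₁ : ℝ) (η : QuantRule K Θ) (δ ψ : TestRule K) : ℝ≥0∞ :=
  ∫⁻ ω, (stopTime ψ ω : ℝ≥0∞) ∂(runLaw (mixLaw P₀ P₁ q κ η))
    + ENNReal.ofReal l₀ * ∫⁻ ω, acceptOne ψ δ ω ∂(runLaw (obsLaw P₀ q η))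
    + ENNReal.ofReal l₁ * ∫⁻ ω, acceptZero ψ δ ω ∂(runLaw (obsLaw P₁ q η))

/-- The optimal weighted cost over all quantization, decision and stopping rules. -/
def optCost {𝒳 Θ : Type*} [MeasurableSpace 𝒳] {K : ℕ}
    (P₀ P₁ : Measure 𝒳) [IsProbabilityMeasure P₀] [IsProbabilityMeasure P₁]
    (q : Θ → 𝒳 → Fin K) (κ l₀ l₁ : ℝ) : ℝ≥0∞ :=
  ⨅ (η : QuantRule K Θ) (δ : TestRule K) (ψ : TestRule K), cost P₀ P₁ q κ l₀ l₁ η δ ψ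

/-! ### The functional equation -/

/-- `D_ρ(z; θ) = ∑ ρ(z Q_{1,θ}(k) / Q_{0,θ}(k)) Q_{0,θ}(k)`, the sum being over the support of
`Q_{0,θ}`. -/
def bellmanD {𝒳 Θ : Type*} [MeasurableSpace 𝒳] {K : ℕ}
    (P₀ P₁ : Measure 𝒳) (q : Θ → 𝒳 → Fin K) (ρ : ℝ≥0 → ℝ≥0) (z : ℝ≥0) (θ : Θ) : ℝ :=
  ∑ k : Fin K with 0 < outProb P₀ q θ k,
    (ρ (z * (outProb P₁ q θ k / outProb P₀ q θ k)) : ℝ) * outProb P₀ q θ k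

/-- `ρ` solves `ρ(z) = min {λ₀, z λ₁, (1 - κ) + κ z + inf_θ D_ρ(z; θ)}` on the nonnegative reals. -/
def IsBellmanSolution {𝒳 Θ : Type*} [MeasurableSpace 𝒳] {K : ℕ}
    (P₀ P₁ : Measure 𝒳) (q : Θ → 𝒳 → Fin K) (κ l₀ l₁ : ℝ) (ρ : ℝ≥0 → ℝ≥0) : Prop :=
  ∀ z : ℝ≥0, (ρ z : ℝ) =
    min l₀ (min (z * l₁) (((1 - κ) + κ * z) + ⨅ θ : Θ, bellmanD P₀ P₁ q ρ z θ))

/-- `s z` minimizes `θ ↦ D_ρ(z; θ)`, for every `z`. -/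
def IsMinSelector {𝒳 Θ : Type*} [MeasurableSpace 𝒳] {K : ℕ}
    (P₀ P₁ : Measure 𝒳) (q : Θ → 𝒳 → Fin K) (ρ : ℝ≥0 → ℝ≥0) (s : ℝ≥0 → Θ) : Prop :=
  ∀ (z : ℝ≥0) (θ : Θ), bellmanD P₀ P₁ q ρ z (s z) ≤ bellmanD P₀ P₁ q ρ z θ

/-! ### Likelihood ratio and threshold tests -/

/-- The running likelihood ratio `z_n` of the quantized observations:
`z_0 = 1` and `z_{n+1} = z_n Q_{1,θ}(Y_{n+1}) / Q_{0,θ}(Y_{n+1})` with `θ = η_n(Y₁, …, Yₙ)`.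
It takes values in `[0, ∞]`; the value `∞` is that of outcomes which are possible only under
`H₁`. -/
def likRatio {𝒳 Θ : Type*} [MeasurableSpace 𝒳] {K : ℕ}
    (P₀ P₁ : Measure 𝒳) (q : Θ → 𝒳 → Fin K) (η : QuantRule K Θ) :
    (n : ℕ) → (Fin n → Fin K) → ℝ≥0∞
  | 0, _ => 1
  | n + 1, y =>
      likRatio P₀ P₁ q η n (Fin.init y) *
        ((outProb P₁ q (η n (Fin.init y)) (y (Fin.last n)) : ℝ≥0∞) /
          (outProb P₀ q (η n (Fin.init y)) (y (Fin.last n)) : ℝ≥0∞))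

/-- The quantization rules `η` choose the parameter `s z_n` at every time `n ≥ 0`, where `z_n` is the
running likelihood ratio (no condition where `z_n = ∞`). -/
def Follows {𝒳 Θ : Type*} [MeasurableSpace 𝒳] {K : ℕ}
    (P₀ P₁ : Measure 𝒳) (q : Θ → 𝒳 → Fin K) (s : ℝ≥0 → Θ) (η : QuantRule K Θ) : Prop :=
  ∀ (n : ℕ) (y : Fin n → Fin K), likRatio P₀ P₁ q η n y ≠ ⊤ →
    η n y = s (likRatio P₀ P₁ q η n y).toNNReal

open Classical in
/-- Stop as soon as `z_n ≥ A` or `z_n ≤ B`. -/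
def thresholdStop {𝒳 Θ : Type*} [MeasurableSpace 𝒳] {K : ℕ}
    (P₀ P₁ : Measure 𝒳) (q : Θ → 𝒳 → Fin K) (η : QuantRule K Θ) (A : ℝ≥0∞) (B : ℝ≥0) :
    TestRule K :=
  fun n y =>
    if A ≤ likRatio P₀ P₁ q η n y ∨ likRatio P₀ P₁ q η n y ≤ (B : ℝ≥0∞) then 1 else 0

open Classical in
/-- Decide for `H₁` if `z_n ≥ A`, and for `H₀` otherwise. -/
def thresholdDecide {𝒳 Θ : Type*} [MeasurableSpace 𝒳] {K : ℕ}
    (P₀ P₁ : Measure 𝒳) (q : Θ → 𝒳 → Fin K) (η : QuantRule K Θ) (A : ℝ≥0∞) :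
    TestRule K :=
  fun n y => if A ≤ likRatio P₀ P₁ q η n y then 1 else 0

end

end QuantizedTest

open QuantizedTest

/-! The proof is dynamic programming. Suppose a history has probability `a` under the first
hypothesis and `b` under the second. Its optimal remaining cost is then the homogeneous quantity `a
* ρ (b / a)` (`pairValue`), so the problem with two measures becomes a Bellman equation in the
single variable `z = b / a`.

A solution is the greatest fixed point of the monotone Bellman operator. Properties stable under the
operator and under infima pass to it, so `ρ` is monotone and `ρ z / z` is nonincreasing
(`exists_isValue`). Uniqueness comes from a multiplicative contraction (`IsValue.contraction`): in a
bound `ρ ≤ (1 + s) * ρ'` the running cost needs no factor, and where `ρ'` continues that cost is at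
least a fixed fraction of `ρ'`.

The cost of any test is a sum of expected costs per time step (`cost_eq_tsum_stepCost`). Each
Bellman inequality bounds the expected optimal remainder `residual` by the current step cost plus
the next remainder. The remainder is also at most a constant times the step cost, so it vanishes
when the total cost is finite; hence no test beats `ρ 1`. Equality up to summable errors gives the
converse (`tsum_stepCost_le`), and no minimizer is needed to identify the optimal cost.

The continuation cost inherits both shape properties. Monotonicity makes the region of deciding for
the second hypothesis an upper set, and the nonincreasing quotient makes the other stopping region a
lower set (`exists_thresholds`). When the running cost alone does not force a threshold to be
nondegenerate, absolute continuity bounds the likelihood ratio of a single output, uniformly in `θ`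
and outside a small event. Perpetual continuation would then make `ρ z`, respectively `ρ z / z`,
unbounded. -/

namespace QuantizedTest

/-! ### The abstract functional equation -/

section FunctionalEquation

variable {Θ ι : Type*} [Fintype ι]

/-- The expectation of `ρ` at the updated likelihood ratio, for output probabilities `p₀`, `p₁`. -/
noncomputable def bellmanSum (p₀ p₁ : Θ → ι → ℝ≥0) (ρ : ℝ≥0 → ℝ≥0) (z : ℝ≥0) (θ : Θ) : ℝ≥0 :=
  ∑ k, p₀ θ k * ρ (z * (p₁ θ k / p₀ θ k))

/-- The cost of continuing at the likelihood ratio `z`. -/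
noncomputable def continuation (p₀ p₁ : Θ → ι → ℝ≥0) (c₀ c₁ : ℝ≥0) (ρ : ℝ≥0 → ℝ≥0) (z : ℝ≥0) :
    ℝ≥0 :=
  c₀ + c₁ * z + ⨅ θ, bellmanSum p₀ p₁ ρ z θ

/-- `ρ` solves the functional equation of optimal stopping. -/
def IsValue (p₀ p₁ : Θ → ι → ℝ≥0) (c₀ c₁ l₀ l₁ : ℝ≥0) (ρ : ℝ≥0 → ℝ≥0) : Prop :=
  ∀ z, ρ z = min l₀ (min (z * l₁) (continuation p₀ p₁ c₀ c₁ ρ z))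

/-- The Bellman operator on extended nonnegative functions. -/
noncomputable def bellmanOp (p₀ p₁ : Θ → ι → ℝ≥0) (c₀ c₁ l₀ l₁ : ℝ≥0) :
    (ℝ≥0 → ℝ≥0∞) →o (ℝ≥0 → ℝ≥0∞) where
  toFun f z := min (l₀ : ℝ≥0∞) (min (z * l₁ : ℝ≥0)
    ((c₀ + c₁ * z : ℝ≥0) + ⨅ θ, ∑ k, (p₀ θ k : ℝ≥0∞) * f (z * (p₁ θ k / p₀ θ k))))
  monotone' f g h z := by
    dsimp only
    gcongr
    exact h _

theorem bellmanOp_apply (p₀ p₁ : Θ → ι → ℝ≥0) (c₀ c₁ l₀ l₁ : ℝ≥0) (f : ℝ≥0 → ℝ≥0∞) (z : ℝ≥0) :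
    bellmanOp p₀ p₁ c₀ c₁ l₀ l₁ f z = min (l₀ : ℝ≥0∞) (min (z * l₁ : ℝ≥0)
      ((c₀ + c₁ * z : ℝ≥0) + ⨅ θ, ∑ k, (p₀ θ k : ℝ≥0∞) * f (z * (p₁ θ k / p₀ θ k)))) :=
  rfl

/-- Monotone functions `f` for which `f z / z` is nonincreasing. -/
def IsSubhomogeneous (f : ℝ≥0 → ℝ≥0) : Prop :=
  Monotone f ∧ ∀ t z : ℝ≥0, t ≤ 1 → t * f z ≤ f (t * z)

variable {p₀ p₁ : Θ → ι → ℝ≥0} {c₀ c₁ l₀ l₁ : ℝ≥0} {ρ ρ' : ℝ≥0 → ℝ≥0}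

/-- Working in `ℝ≥0∞` gives a complete lattice, so Knaster–Tarski applies without any continuity of
the operator; the cap `l₀` makes the fixed point finite. The greatest fixed point is taken because
monotonicity and subhomogeneity survive infima. -/
theorem exists_isValue [Nonempty Θ] (p₀ p₁ : Θ → ι → ℝ≥0) (c₀ c₁ l₀ l₁ : ℝ≥0) :
    ∃ ρ, IsValue p₀ p₁ c₀ c₁ l₀ l₁ ρ ∧ IsSubhomogeneous ρ := by
  set T := bellmanOp p₀ p₁ c₀ c₁ l₀ l₁ with hT
  have hfix : T T.gfp = T.gfp := T.map_gfp
  have hfin : ∀ z, T.gfp z ≠ ⊤ := fun z => by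
    rw [← hfix]
    exact ne_top_of_le_ne_top ENNReal.coe_ne_top (min_le_left _ _)
  have hcoe : ∀ z, ((T.gfp z).toNNReal : ℝ≥0∞) = T.gfp z := fun z => ENNReal.coe_toNNReal (hfin z)
  have hsub : Monotone T.gfp ∧ ∀ t z : ℝ≥0, t ≤ 1 → (t : ℝ≥0∞) * T.gfp z ≤ T.gfp (t * z) := by
    refine OrderHom.gfp_induction
      (p := fun f => Monotone f ∧ ∀ t z : ℝ≥0, t ≤ 1 → (t : ℝ≥0∞) * f z ≤ f (t * z)) T ?_ ?_
    · rintro f ⟨hm, hs⟩ -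
      refine ⟨fun z w hzw => ?_, fun t z ht => ?_⟩
      · rw [hT, bellmanOp_apply, bellmanOp_apply]
        gcongr
        apply hm
        gcongr
      · rw [hT, bellmanOp_apply, bellmanOp_apply]
        have ht' : (t : ℝ≥0∞) ≤ 1 := by exact_mod_cast ht
        refine le_min ?_ (le_min ?_ ?_)
        · exact (mul_le_of_le_one_left' ht').trans (min_le_left _ _)
        · calc _ ≤ (t : ℝ≥0∞) * (z * l₁ : ℝ≥0) := by
                gcongr; exact (min_le_right _ _).trans (min_le_left _ _)
            _ = _ := by rw [← ENNReal.coe_mul, mul_assoc]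
        · calc _ ≤ (t : ℝ≥0∞) * ((c₀ + c₁ * z : ℝ≥0) +
                  ⨅ θ, ∑ k, (p₀ θ k : ℝ≥0∞) * f (z * (p₁ θ k / p₀ θ k))) := by
                gcongr; exact (min_le_right _ _).trans (min_le_right _ _)
            _ ≤ _ := by
                rw [mul_add]
                gcongr
                · rw [← ENNReal.coe_mul, ENNReal.coe_le_coe, mul_add]
                  exact add_le_add (mul_le_of_le_one_left' ht) (mul_left_comm _ _ _).le
                · refine le_iInf fun θ => ?_
                  refine (mul_le_mul_right (iInf_le _ θ) _).trans ?_
                  rw [Finset.mul_sum]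
                  refine Finset.sum_le_sum fun k _ => ?_
                  rw [mul_left_comm, mul_assoc]
                  gcongr
                  exact hs _ _ ht
    · intro s hs
      refine ⟨fun z w hzw => ?_, fun t z ht => ?_⟩
      · simp only [sInf_apply]
        exact le_iInf fun f => (iInf_le _ f).trans ((hs f f.2).1 hzw)
      · simp only [sInf_apply]
        refine le_iInf fun f => ?_
        exact (mul_le_mul_right (iInf_le _ f) _).trans ((hs f f.2).2 t z ht)
  refine ⟨fun z => (T.gfp z).toNNReal, fun z => ?_, fun z w hzw => ?_, fun t z ht => ?_⟩
  · rw [← ENNReal.coe_inj, hcoe, ← congrFun hfix z]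
    conv_lhs => rw [hT]
    rw [bellmanOp_apply, ← hT]
    simp only [continuation, bellmanSum]
    push_cast
    simp only [hcoe]
  · rw [← ENNReal.coe_le_coe, hcoe, hcoe]
    exact hsub.1 hzw
  · rw [← ENNReal.coe_le_coe, ENNReal.coe_mul, hcoe, hcoe]
    exact hsub.2 t z ht

theorem IsValue.le_left (h : IsValue p₀ p₁ c₀ c₁ l₀ l₁ ρ) (z : ℝ≥0) : ρ z ≤ l₀ :=
  (h z).trans_le (min_le_left _ _)

theorem IsValue.le_mul (h : IsValue p₀ p₁ c₀ c₁ l₀ l₁ ρ) (z : ℝ≥0) : ρ z ≤ z * l₁ :=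
  (h z).trans_le ((min_le_right _ _).trans (min_le_left _ _))

theorem IsValue.le_continuation (h : IsValue p₀ p₁ c₀ c₁ l₀ l₁ ρ) (z : ℝ≥0) :
    ρ z ≤ continuation p₀ p₁ c₀ c₁ ρ z :=
  (h z).trans_le ((min_le_right _ _).trans (min_le_right _ _))

/-- A minimum is at most the convex combination with weights `c₀`, `c₁`. This makes the cost of
stopping at once comparable with one step of running cost, even if one of the weights is zero. -/
theorem min_mul_le_of_add_eq_one (hc : c₀ + c₁ = 1) (a b : ℝ≥0) :
    min (a * l₀) (b * l₁) ≤ (1 + l₀ + l₁) * (c₀ * a + c₁ * b) := by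
  calc min (a * l₀) (b * l₁)
      = c₀ * min (a * l₀) (b * l₁) + c₁ * min (a * l₀) (b * l₁) := by rw [← add_mul, hc, one_mul]
    _ ≤ c₀ * (a * l₀) + c₁ * (b * l₁) := by
        gcongr
        · exact min_le_left _ _
        · exact min_le_right _ _
    _ = l₀ * (c₀ * a) + l₁ * (c₁ * b) := by ring
    _ ≤ (1 + l₀ + l₁) * (c₀ * a) + (1 + l₀ + l₁) * (c₁ * b) := by
        gcongr
        · exact le_add_right le_add_self
        · exact le_add_self
    _ = _ := by ring

theorem IsValue.contraction [Nonempty Θ] (hc : c₀ + c₁ = 1)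
    (h : IsValue p₀ p₁ c₀ c₁ l₀ l₁ ρ) (h' : IsValue p₀ p₁ c₀ c₁ l₀ l₁ ρ') {s : ℝ≥0}
    (hs : ∀ z, ρ z ≤ (1 + s) * ρ' z) (z : ℝ≥0) :
    ρ z ≤ (1 + (1 - (1 + l₀ + l₁)⁻¹) * s) * ρ' z := by
  set C := 1 + l₀ + l₁ with hC
  have hC1 : 1 ≤ C := by rw [hC, add_assoc]; exact le_self_add
  have hC0 : C ≠ 0 := (zero_lt_one.trans_le hC1).ne'
  have hinv : 1 - C⁻¹ + C⁻¹ = 1 := tsub_add_cancel_of_le (inv_le_one_of_one_le₀ hC1)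
  have hbound : ρ z ≤ ρ' z → ρ z ≤ (1 + (1 - C⁻¹) * s) * ρ' z := fun hle =>
    hle.trans (le_mul_of_one_le_left' le_self_add)
  rcases le_total (min l₀ (z * l₁)) (continuation p₀ p₁ c₀ c₁ ρ' z) with hcase | hcase
  · apply hbound
    rw [h' z, ← min_assoc, min_eq_left hcase]
    exact le_min (h.le_left z) (h.le_mul z)
  · have hρ' : ρ' z = continuation p₀ p₁ c₀ c₁ ρ' z := by
      rw [h' z, ← min_assoc, min_eq_right hcase]
    have hsmall : ρ' z ≤ C * (c₀ + c₁ * z) := by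
      have := min_mul_le_of_add_eq_one (l₀ := l₀) (l₁ := l₁) hc 1 z
      rw [one_mul, mul_one] at this
      exact (le_min (h'.le_left z) (h'.le_mul z)).trans this
    have hsmall' : C⁻¹ * ρ' z ≤ c₀ + c₁ * z := by
      calc C⁻¹ * ρ' z ≤ C⁻¹ * (C * (c₀ + c₁ * z)) := by gcongr
        _ = _ := by rw [← mul_assoc, inv_mul_cancel₀ hC0, one_mul]
    have hD : ⨅ θ, bellmanSum p₀ p₁ ρ z θ ≤ (1 + s) * ⨅ θ, bellmanSum p₀ p₁ ρ' z θ := by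
      rw [NNReal.mul_iInf]
      refine ciInf_mono (OrderBot.bddBelow _) fun θ => ?_
      rw [bellmanSum, bellmanSum, Finset.mul_sum]
      refine Finset.sum_le_sum fun k _ => ?_
      rw [mul_left_comm]
      gcongr
      exact hs _
    set D' := ⨅ θ, bellmanSum p₀ p₁ ρ' z θ with hD'
    -- Only the future term of `ρ'` has to be inflated by `1 + s`; inflating the running cost as
    -- well leaves the surplus `s * (c₀ + c₁ * z)`.
    have hle : ρ z + s * (c₀ + c₁ * z) ≤ (1 + s) * ρ' z := by
      calc ρ z + s * (c₀ + c₁ * z)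
          ≤ (c₀ + c₁ * z + (1 + s) * D') + s * (c₀ + c₁ * z) := by
            gcongr
            exact (h.le_continuation z).trans (by rw [continuation]; gcongr)
        _ = (1 + s) * ρ' z := by rw [hρ', continuation]; ring
    have hle' : ρ z + s * (C⁻¹ * ρ' z) ≤ (1 + (1 - C⁻¹) * s) * ρ' z + s * (C⁻¹ * ρ' z) := by
      calc ρ z + s * (C⁻¹ * ρ' z) ≤ ρ z + s * (c₀ + c₁ * z) := by gcongr
        _ ≤ (1 + (1 - C⁻¹ + C⁻¹) * s) * ρ' z := by rw [hinv, one_mul]; exact hle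
        _ = _ := by ring
    exact le_of_add_le_add_right hle'

/-- Iterating the contraction drives the excess factor to zero geometrically. -/
theorem IsValue.le [Nonempty Θ] (hc : c₀ + c₁ = 1)
    (h : IsValue p₀ p₁ c₀ c₁ l₀ l₁ ρ) (h' : IsValue p₀ p₁ c₀ c₁ l₀ l₁ ρ') : ρ ≤ ρ' := by
  set C := 1 + l₀ + l₁ with hC
  have hC1 : 1 ≤ C := by rw [hC, add_assoc]; exact le_self_add
  -- Where `ρ'` stops it equals the stopping cost, which dominates `ρ`; where it continues, `C`
  -- times its running cost already dominates the stopping cost.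
  have hstart : ∀ z, ρ z ≤ (1 + C) * ρ' z := fun z => by
    have hmin : ρ z ≤ min l₀ (z * l₁) := le_min (h.le_left z) (h.le_mul z)
    rw [h' z, ← min_assoc]
    rcases le_total (min l₀ (z * l₁)) (continuation p₀ p₁ c₀ c₁ ρ' z) with hcase | hcase
    · rw [min_eq_left hcase]
      exact hmin.trans (le_mul_of_one_le_left' le_self_add)
    · rw [min_eq_right hcase]
      have := min_mul_le_of_add_eq_one (l₀ := l₀) (l₁ := l₁) hc 1 z
      rw [one_mul, mul_one] at this
      calc ρ z ≤ C * (c₀ + c₁ * z) := hmin.trans this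
        _ ≤ _ := by
          rw [continuation]
          exact mul_le_mul' le_add_self le_self_add
  have hiter : ∀ n : ℕ, ∀ z, ρ z ≤ (1 + (1 - C⁻¹) ^ n * C) * ρ' z := by
    intro n
    induction n with
    | zero => simpa using hstart
    | succ n ih =>
      intro z
      have := h.contraction hc h' ih z
      rwa [← mul_assoc, ← pow_succ'] at this
  intro z
  have hlt : 1 - C⁻¹ < 1 :=
    tsub_lt_self zero_lt_one (inv_pos.2 (zero_lt_one.trans_le hC1))
  have hlim : Filter.Tendsto (fun n : ℕ => (1 + (1 - C⁻¹) ^ n * C) * ρ' z) Filter.atTop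
      (nhds ((1 + 0 * C) * ρ' z)) :=
    (((NNReal.tendsto_pow_atTop_nhds_zero_of_lt_one hlt).mul_const C).const_add 1).mul_const _
  rw [zero_mul, add_zero, one_mul] at hlim
  exact ge_of_tendsto' hlim fun n => hiter n z

theorem IsValue.unique [Nonempty Θ] (hc : c₀ + c₁ = 1)
    (h : IsValue p₀ p₁ c₀ c₁ l₀ l₁ ρ) (h' : IsValue p₀ p₁ c₀ c₁ l₀ l₁ ρ') : ρ = ρ' :=
  le_antisymm (h.le hc h') (h'.le hc h)

end FunctionalEquation

/-! ### Thresholds -/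

section Thresholds

variable {Θ ι : Type*} [Fintype ι]
variable {p₀ p₁ : Θ → ι → ℝ≥0} {c₀ c₁ l₀ l₁ : ℝ≥0} {ρ : ℝ≥0 → ℝ≥0}

/-- The division-free form of the monotonicity of `f z / z`, valid at zero too. -/
theorem IsSubhomogeneous.mul_le_mul_of_le {f : ℝ≥0 → ℝ≥0} (hf : IsSubhomogeneous f) {z w : ℝ≥0}
    (hzw : z ≤ w) : z * f w ≤ w * f z := by
  rcases eq_zero_or_pos w with rfl | hw
  · simp [nonpos_iff_eq_zero.1 hzw]
  · have h := hf.2 (z / w) w (div_le_one_of_le₀ hzw zero_le)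
    rw [div_mul_cancel₀ _ hw.ne'] at h
    calc z * f w = w * (z / w * f w) := by rw [← mul_assoc, mul_div_cancel₀ _ hw.ne']
      _ ≤ w * f z := by gcongr

theorem IsSubhomogeneous.bellmanSum (hρ : IsSubhomogeneous ρ) (θ : Θ) :
    IsSubhomogeneous fun z => bellmanSum p₀ p₁ ρ z θ := by
  refine ⟨fun z w hzw => Finset.sum_le_sum fun k _ => ?_, fun t z ht => ?_⟩
  · gcongr
    apply hρ.1
    gcongr
  · simp only [QuantizedTest.bellmanSum, Finset.mul_sum]
    refine Finset.sum_le_sum fun k _ => ?_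
    rw [mul_left_comm, mul_assoc]
    gcongr
    exact hρ.2 _ _ ht

theorem IsSubhomogeneous.continuation [Nonempty Θ] (hρ : IsSubhomogeneous ρ) :
    IsSubhomogeneous (continuation p₀ p₁ c₀ c₁ ρ) := by
  refine ⟨fun z w hzw => ?_, fun t z ht => ?_⟩
  · refine add_le_add (by gcongr) (ciInf_mono (OrderBot.bddBelow _) fun θ => ?_)
    exact (hρ.bellmanSum θ).1 hzw
  · simp only [QuantizedTest.continuation, mul_add]
    refine add_le_add (add_le_add (mul_le_of_le_one_left' ht) (mul_left_comm _ _ _).le) ?_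
    rw [NNReal.mul_iInf]
    exact ciInf_mono (OrderBot.bddBelow _) fun θ => (hρ.bellmanSum θ).2 t z ht

theorem le_mul_of_forall_gt {a b z : ℝ≥0} (h : ∀ w, z < w → a ≤ w * b) : a ≤ z * b := by
  have hlim : Filter.Tendsto (fun w : ℝ≥0 => w * b) (nhdsWithin z (Set.Ioi z)) (nhds (z * b)) :=
    (Filter.tendsto_id.mul_const b).mono_left nhdsWithin_le_nhds
  exact ge_of_tendsto hlim (Filter.eventually_of_mem self_mem_nhdsWithin h)

theorem mul_le_of_forall_lt {a b z : ℝ≥0} (hb : 0 < b) (h : ∀ w, w < z → w * b ≤ a) :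
    z * b ≤ a := by
  refine le_of_forall_lt_imp_le_of_dense fun c hc => ?_
  have := h (c / b) (by rwa [div_lt_iff₀ hb])
  rwa [div_mul_cancel₀ _ hb.ne'] at this

/-- The stopping and continuation regions are separated by two thresholds. -/
theorem exists_thresholds {g : ℝ≥0 → ℝ≥0} (hg : IsSubhomogeneous g) (hl₀ : 0 < l₀)
    (hl₁ : 0 < l₁) :
    ∃ (A : ℝ≥0∞) (B : ℝ≥0), 0 < A ∧ (B : ℝ≥0∞) ≤ A ∧
      (∀ z : ℝ≥0, l₀ ≤ z * l₁ → l₀ ≤ g z → A < ⊤) ∧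
      (∀ z : ℝ≥0, 0 < z → z * l₁ ≤ l₀ → z * l₁ ≤ g z → 0 < B) ∧
      (∀ z : ℝ≥0, A ≤ z → l₀ ≤ z * l₁ ∧ l₀ ≤ g z) ∧
      (∀ z ≤ B, z * l₁ ≤ l₀ ∧ z * l₁ ≤ g z) ∧
      (∀ z : ℝ≥0, B < z → z < A → g z ≤ min l₀ (z * l₁)) := by
  set U : Set ℝ≥0 := {z | l₀ ≤ z * l₁ ∧ l₀ ≤ g z} with hU
  set L : Set ℝ≥0 := {z | z * l₁ ≤ l₀ ∧ z * l₁ ≤ g z} with hL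
  have hU_up : ∀ z ∈ U, ∀ w, z ≤ w → w ∈ U := fun z hz w hzw =>
    ⟨hz.1.trans (by gcongr), hz.2.trans (hg.1 hzw)⟩
  have hL_down : ∀ z ∈ L, ∀ w, w ≤ z → w ∈ L := fun z hz w hwz => by
    refine ⟨le_trans (by gcongr) hz.1, ?_⟩
    rcases eq_zero_or_pos z with rfl | hz0
    · simp [nonpos_iff_eq_zero.1 hwz]
    · refine le_of_mul_le_mul_left ?_ hz0
      calc z * (w * l₁) = w * (z * l₁) := by ring
        _ ≤ w * g z := by gcongr; exact hz.2
        _ ≤ z * g w := hg.mul_le_mul_of_le hwz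
  have hL_le : ∀ z ∈ L, z ≤ l₀ / l₁ := fun z hz => (le_div_iff₀ hl₁).2 hz.1
  have hU_ge : ∀ z ∈ U, l₀ / l₁ ≤ z := fun z hz => (div_le_iff₀ hl₁).2 hz.1
  have hL_bdd : BddAbove L := ⟨_, hL_le⟩
  have hL0 : (0 : ℝ≥0) ∈ L := by simp [hL]
  -- The point `l₀ / l₁`, where both decisions cost the same, separates `L` from `U`. Taking the
  -- infimum in `ℝ≥0∞` gives `⊤` when `U` is empty.
  have hA_ge : ((l₀ / l₁ : ℝ≥0) : ℝ≥0∞) ≤ ⨅ z ∈ U, (z : ℝ≥0∞) :=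
    le_iInf₂ fun z hz => ENNReal.coe_le_coe.2 (hU_ge z hz)
  have hB_le : sSup L ≤ l₀ / l₁ := csSup_le ⟨0, hL0⟩ hL_le
  have hA_mem : ∀ z : ℝ≥0, (⨅ z ∈ U, (z : ℝ≥0∞)) ≤ z → z ∈ U := fun z hz => by
    have hgt : ∀ w, z < w → w ∈ U := fun w hw => by
      have : (⨅ z ∈ U, (z : ℝ≥0∞)) < w := hz.trans_lt (ENNReal.coe_lt_coe.2 hw)
      simp only [iInf_lt_iff] at this
      obtain ⟨u, hu, huw⟩ := this
      exact hU_up u hu w (ENNReal.coe_lt_coe.1 huw).le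
    have h1 : l₀ ≤ z * l₁ := le_mul_of_forall_gt fun w hw => (hgt w hw).1
    have hz0 : 0 < z := pos_of_ne_zero fun h0 => by simp [h0, hl₀.ne'] at h1
    -- Subhomogeneity replaces right continuity of `g`: `z * l₀ ≤ z * g w ≤ w * g z` for `w > z`,
    -- and then `w` decreases to `z`.
    refine ⟨h1, le_of_mul_le_mul_left (le_mul_of_forall_gt fun w hw => ?_) hz0⟩
    exact le_trans (by gcongr; exact (hgt w hw).2) (hg.mul_le_mul_of_le hw.le)
  have hB_mem : ∀ z ≤ sSup L, z ∈ L := fun z hz => by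
    have hlt : ∀ w, w < z → w ∈ L := fun w hw => by
      obtain ⟨u, hu, hwu⟩ := exists_lt_of_lt_csSup ⟨0, hL0⟩ (hw.trans_le hz)
      exact hL_down u hu w hwu.le
    exact ⟨mul_le_of_forall_lt hl₁ fun w hw => (hlt w hw).1,
      mul_le_of_forall_lt hl₁ fun w hw => (hlt w hw).2.trans (hg.1 hw.le)⟩
  refine ⟨⨅ z ∈ U, (z : ℝ≥0∞), sSup L, ?_, (ENNReal.coe_le_coe.2 hB_le).trans hA_ge, ?_, ?_,
    hA_mem, hB_mem, ?_⟩
  · exact lt_of_lt_of_le (ENNReal.coe_pos.2 (div_pos hl₀ hl₁)) hA_ge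
  · exact fun z h1 h2 => (iInf₂_le z ⟨h1, h2⟩).trans_lt ENNReal.coe_lt_top
  · exact fun z hz h1 h2 => hz.trans_le (le_csSup hL_bdd ⟨h1, h2⟩)
  · intro z hBz hzA
    have hzU : z ∉ U := fun hz =>
      (iInf₂_le (f := fun (u : ℝ≥0) (_ : u ∈ U) => (u : ℝ≥0∞)) z hz).not_gt hzA
    have hzL : z ∉ L := fun hz => (le_csSup hL_bdd hz).not_gt hBz
    by_contra hlt
    rw [not_le] at hlt
    rcases le_total l₀ (z * l₁) with h | h
    · exact hzU ⟨h, by rw [min_eq_left h] at hlt; exact hlt.le⟩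
    · exact hzL ⟨h, by rw [min_eq_right h] at hlt; exact hlt.le⟩

/-! ### Nondegeneracy of the thresholds -/

theorem exists_le_continuation_of_pos (hc₁ : 0 < c₁) (hl₁ : 0 < l₁) :
    ∃ z, l₀ ≤ z * l₁ ∧ l₀ ≤ continuation p₀ p₁ c₀ c₁ ρ z := by
  refine ⟨max (l₀ / l₁) (l₀ / c₁), ?_, ?_⟩
  · rw [← div_le_iff₀ hl₁]
    exact le_max_left _ _
  · have h : l₀ ≤ c₁ * max (l₀ / l₁) (l₀ / c₁) := by
      rw [mul_comm, ← div_le_iff₀ hc₁]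
      exact le_max_right _ _
    exact h.trans (le_add_self.trans le_self_add)

theorem exists_mul_le_continuation_of_pos (hc₀ : 0 < c₀) (hl₀ : 0 < l₀) (hl₁ : 0 < l₁) :
    ∃ z, 0 < z ∧ z * l₁ ≤ l₀ ∧ z * l₁ ≤ continuation p₀ p₁ c₀ c₁ ρ z := by
  refine ⟨min (l₀ / l₁) (c₀ / l₁), lt_min (div_pos hl₀ hl₁) (div_pos hc₀ hl₁), ?_, ?_⟩
  · rw [← le_div_iff₀ hl₁]
    exact min_le_left _ _
  · have h : min (l₀ / l₁) (c₀ / l₁) * l₁ ≤ c₀ := by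
      rw [← le_div_iff₀ hl₁]
      exact min_le_right _ _
    exact h.trans (le_self_add.trans le_self_add)

/-- If continuing were cheaper than `l₀` at every large `z`, one step would cost `c₀` and, outside a
small event, leave the ratio above `z * r`. So `ρ` would grow by a fixed amount each time `z` is
divided by `r`, against `ρ ≤ l₀`. -/
theorem exists_le_continuation [Nonempty Θ] (h : IsValue p₀ p₁ c₀ c₁ l₀ l₁ ρ)
    (hρ : IsSubhomogeneous ρ) (hp₀ : ∀ θ, ∑ k, p₀ θ k = 1) (hc₀ : 0 < c₀) (hl₀ : 0 < l₀)
    (hl₁ : 0 < l₁)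
    (hac : ∀ ε : ℝ≥0, 0 < ε → ∃ r : ℝ≥0, 0 < r ∧
      ∀ θ, ∑ k with p₁ θ k < r * p₀ θ k, p₀ θ k ≤ ε) :
    ∃ z, l₀ ≤ z * l₁ ∧ l₀ ≤ continuation p₀ p₁ c₀ c₁ ρ z := by
  by_contra! hno
  -- The bad outputs lose at most `l₀` each time they occur, so this tolerance spends half of `c₀`
  -- on them.
  obtain ⟨r, hr, hbad⟩ := hac (c₀ / 2 / l₀) (by positivity)
  have hstep : ∀ z, l₀ / l₁ ≤ z → ρ (z * r) + c₀ / 2 ≤ ρ z := fun z hz => by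
    have hz' : l₀ ≤ z * l₁ := (div_le_iff₀ hl₁).1 hz
    have hcont := hno z hz'
    have hval : ρ z = continuation p₀ p₁ c₀ c₁ ρ z := by
      rw [h z, min_eq_right (hcont.le.trans hz'), min_eq_right hcont.le]
    have hD : ∀ θ, ρ (z * r) ≤ bellmanSum p₀ p₁ ρ z θ + c₀ / 2 := fun θ => by
      have hterm : ∀ k, p₀ θ k * ρ (z * r) ≤ p₀ θ k * ρ (z * (p₁ θ k / p₀ θ k)) +
          if p₁ θ k < r * p₀ θ k then p₀ θ k * ρ (z * r) else 0 := fun k => by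
        split_ifs with hk
        · exact le_add_self
        · rw [add_zero]
          rcases eq_zero_or_pos (p₀ θ k) with h0 | h0
          · simp [h0]
          · gcongr
            apply hρ.1
            gcongr
            exact (le_div_iff₀ h0).2 (not_lt.1 hk)
      calc ρ (z * r) = ∑ k, p₀ θ k * ρ (z * r) := by rw [← Finset.sum_mul, hp₀, one_mul]
        _ ≤ ∑ k, (p₀ θ k * ρ (z * (p₁ θ k / p₀ θ k)) +
              if p₁ θ k < r * p₀ θ k then p₀ θ k * ρ (z * r) else 0) :=
            Finset.sum_le_sum fun k _ => hterm k
        _ = bellmanSum p₀ p₁ ρ z θ + (∑ k with p₁ θ k < r * p₀ θ k, p₀ θ k) * ρ (z * r) := by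
            rw [Finset.sum_add_distrib, ← Finset.sum_filter, Finset.sum_mul]
            rfl
        _ ≤ bellmanSum p₀ p₁ ρ z θ + c₀ / 2 / l₀ * l₀ := by
            gcongr
            · exact hbad θ
            · exact h.le_left _
        _ = _ := by rw [div_mul_cancel₀ _ hl₀.ne']
    have hinf : ρ (z * r) ≤ (⨅ θ, bellmanSum p₀ p₁ ρ z θ) + c₀ / 2 := by
      rw [← tsub_le_iff_right]
      exact le_ciInf fun θ => tsub_le_iff_right.2 (hD θ)
    have : ρ (z * r) + c₀ / 2 + c₀ / 2 ≤ ρ z + c₀ / 2 := by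
      calc ρ (z * r) + c₀ / 2 + c₀ / 2 = c₀ + ρ (z * r) := by
            rw [add_assoc, add_halves, add_comm]
        _ ≤ c₀ + ((⨅ θ, bellmanSum p₀ p₁ ρ z θ) + c₀ / 2) := by gcongr
        _ ≤ c₀ + c₁ * z + ((⨅ θ, bellmanSum p₀ p₁ ρ z θ) + c₀ / 2) := by
            gcongr
            exact le_self_add
        _ = ρ z + c₀ / 2 := by rw [hval, continuation]; ring
    exact le_of_add_le_add_right this
  have hiter : ∀ n : ℕ, ∃ z, n * (c₀ / 2) ≤ ρ z := by
    intro n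
    induction n with
    | zero => exact ⟨0, by simp⟩
    | succ n ih =>
      obtain ⟨z, hz⟩ := ih
      -- Large enough both for `hstep` to apply and for its product with `r` to be at least `z`.
      refine ⟨max (z / r) (l₀ / l₁), ?_⟩
      rw [Nat.cast_succ, add_mul, one_mul]
      refine le_trans ?_ (hstep _ (le_max_right _ _))
      gcongr
      refine hz.trans (hρ.1 ?_)
      rw [← div_le_iff₀ hr]
      exact le_max_left _ _
  obtain ⟨n, hn⟩ := exists_nat_gt (l₀ / (c₀ / 2))
  rw [div_lt_iff₀ (by positivity)] at hn
  obtain ⟨z, hz⟩ := hiter n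
  exact (hn.trans_le (hz.trans (h.le_left z))).false

/-- The mirror image of `exists_le_continuation`, with the hypotheses exchanged and `ρ z / z` in
place of `ρ z`: passing from `w` to `r * w` would raise this quotient by `c₁ / 2`, against its bound
`l₁`. -/
theorem exists_mul_le_continuation [Nonempty Θ] (h : IsValue p₀ p₁ c₀ c₁ l₀ l₁ ρ)
    (hρ : IsSubhomogeneous ρ) (hp₁ : ∀ θ, ∑ k, p₁ θ k = 1) (hc₁ : 0 < c₁) (hl₀ : 0 < l₀)
    (hl₁ : 0 < l₁)
    (hac : ∀ ε : ℝ≥0, 0 < ε → ∃ r : ℝ≥0, 0 < r ∧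
      ∀ θ, ∑ k with p₀ θ k < r * p₁ θ k, p₁ θ k ≤ ε) :
    ∃ z, 0 < z ∧ z * l₁ ≤ l₀ ∧ z * l₁ ≤ continuation p₀ p₁ c₀ c₁ ρ z := by
  by_contra! hno
  obtain ⟨r, hr, hbad⟩ := hac (c₁ / 2 / l₁) (by positivity)
  have hstep : ∀ w, 0 < w → w ≤ l₀ / l₁ / r → r * ρ w + c₁ / 2 * (r * w) ≤ ρ (r * w) :=
      fun w hw hwz => by
    have hz : 0 < r * w := mul_pos hr hw
    have hz' : r * w * l₁ ≤ l₀ := by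
      rwa [le_div_iff₀ hr, le_div_iff₀ hl₁, mul_comm w] at hwz
    have hcont := hno _ hz hz'
    have hval : ρ (r * w) = continuation p₀ p₁ c₀ c₁ ρ (r * w) := by
      rw [h (r * w), min_eq_right hcont.le, min_eq_right (hcont.le.trans hz')]
    have hD : ∀ θ, r * ρ w ≤ bellmanSum p₀ p₁ ρ (r * w) θ + c₁ / 2 * (r * w) := fun θ => by
      have hterm : ∀ k, p₁ θ k * (r * ρ w) ≤ p₀ θ k * ρ (r * w * (p₁ θ k / p₀ θ k)) +
          if p₀ θ k < r * p₁ θ k then p₁ θ k * (r * ρ w) else 0 := fun k => by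
        split_ifs with hk
        · exact le_add_self
        · rw [add_zero]
          rw [not_lt] at hk
          rcases eq_zero_or_pos (p₀ θ k) with h0 | h0
          · have : p₁ θ k = 0 := by
              rw [h0] at hk
              simpa [hr.ne'] using hk
            simp [this]
          -- For a good output the new ratio is at most `w`, so subhomogeneity applies with this
          -- scaling factor.
          · have := hρ.2 (r * p₁ θ k / p₀ θ k) w ((div_le_one h0).2 hk)
            calc p₁ θ k * (r * ρ w) = p₀ θ k * (r * p₁ θ k / p₀ θ k * ρ w) := by
                  field_simp
              _ ≤ p₀ θ k * ρ (r * p₁ θ k / p₀ θ k * w) := by gcongr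
              _ = _ := by congr 2; field_simp
      calc r * ρ w = ∑ k, p₁ θ k * (r * ρ w) := by rw [← Finset.sum_mul, hp₁, one_mul]
        _ ≤ ∑ k, (p₀ θ k * ρ (r * w * (p₁ θ k / p₀ θ k)) +
              if p₀ θ k < r * p₁ θ k then p₁ θ k * (r * ρ w) else 0) :=
            Finset.sum_le_sum fun k _ => hterm k
        _ = bellmanSum p₀ p₁ ρ (r * w) θ +
              (∑ k with p₀ θ k < r * p₁ θ k, p₁ θ k) * (r * ρ w) := by
            rw [Finset.sum_add_distrib, ← Finset.sum_filter, Finset.sum_mul]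
            rfl
        _ ≤ bellmanSum p₀ p₁ ρ (r * w) θ + c₁ / 2 / l₁ * (r * (w * l₁)) := by
            gcongr
            · exact hbad θ
            · exact h.le_mul _
        _ = _ := by congr 1; field_simp
    have hinf : r * ρ w ≤ (⨅ θ, bellmanSum p₀ p₁ ρ (r * w) θ) + c₁ / 2 * (r * w) := by
      rw [← tsub_le_iff_right]
      exact le_ciInf fun θ => tsub_le_iff_right.2 (hD θ)
    have : r * ρ w + c₁ / 2 * (r * w) + c₁ / 2 * (r * w) ≤ ρ (r * w) + c₁ / 2 * (r * w) := by
      calc r * ρ w + c₁ / 2 * (r * w) + c₁ / 2 * (r * w) = c₁ * (r * w) + r * ρ w := by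
            rw [add_assoc, ← add_mul, add_halves, add_comm]
        _ ≤ c₁ * (r * w) + ((⨅ θ, bellmanSum p₀ p₁ ρ (r * w) θ) + c₁ / 2 * (r * w)) := by
            gcongr
        _ ≤ c₀ + c₁ * (r * w) +
              ((⨅ θ, bellmanSum p₀ p₁ ρ (r * w) θ) + c₁ / 2 * (r * w)) := by
            gcongr
            exact le_add_self
        _ = ρ (r * w) + c₁ / 2 * (r * w) := by rw [hval, continuation]; ring
    exact le_of_add_le_add_right this
  have hiter : ∀ n : ℕ, ∃ z, 0 < z ∧ n * (c₁ / 2) * z ≤ ρ z := by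
    intro n
    induction n with
    | zero => exact ⟨1, one_pos, by simp⟩
    | succ n ih =>
      obtain ⟨z, hz0, hz⟩ := ih
      -- Truncation puts the point in the range of `hstep`; the bound on `ρ z / z` persists because
      -- the quotient is nonincreasing.
      set u := min z (l₀ / l₁ / r) with hu
      have hu0 : 0 < u := lt_min hz0 (by positivity)
      have hρu : n * (c₁ / 2) * u ≤ ρ u := by
        refine le_of_mul_le_mul_left ?_ hz0
        calc z * (n * (c₁ / 2) * u) = u * (n * (c₁ / 2) * z) := by ring
          _ ≤ u * ρ z := by gcongr
          _ ≤ z * ρ u := hρ.mul_le_mul_of_le (min_le_left _ _)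
      refine ⟨r * u, mul_pos hr hu0, le_trans ?_ (hstep u hu0 (min_le_right _ _))⟩
      calc ((n + 1 : ℕ) : ℝ≥0) * (c₁ / 2) * (r * u)
          = r * (n * (c₁ / 2) * u) + c₁ / 2 * (r * u) := by push_cast; ring
        _ ≤ _ := by gcongr
  obtain ⟨n, hn⟩ := exists_nat_gt (l₁ / (c₁ / 2))
  rw [div_lt_iff₀ (by positivity)] at hn
  obtain ⟨z, hz0, hz⟩ := hiter n
  have := hz.trans (h.le_mul z)
  rw [mul_comm z] at this
  exact (hn.trans_le (le_of_mul_le_mul_right this hz0)).false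

/-! ### Attainment of the infimum -/

/-- Since `ρ z / z` is nonincreasing, increments have slope at most `ρ z / z`, hence at most `l₁`.
-/
theorem IsValue.lipschitzWith (h : IsValue p₀ p₁ c₀ c₁ l₀ l₁ ρ) (hρ : IsSubhomogeneous ρ) :
    LipschitzWith l₁ ρ := by
  have key : ∀ z w, z ≤ w → ρ w ≤ ρ z + l₁ * (w - z) := fun z w hzw => by
    rcases eq_zero_or_pos z with rfl | hz
    · rw [tsub_zero, mul_comm]
      exact (h.le_mul w).trans le_add_self
    · refine le_of_mul_le_mul_left ?_ hz
      calc z * ρ w ≤ w * ρ z := hρ.mul_le_mul_of_le hzw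
        _ = z * ρ z + (w - z) * ρ z := by rw [← add_mul, add_tsub_cancel_of_le hzw]
        _ ≤ z * ρ z + (w - z) * (z * l₁) := by gcongr; exact h.le_mul z
        _ = _ := by ring
  have : LipschitzWith l₁ fun z => (ρ z : ℝ) := LipschitzWith.of_le_add_mul l₁ fun z w => by
    rcases le_total z w with hzw | hwz
    · exact (NNReal.coe_le_coe.2 (hρ.1 hzw)).trans (le_add_of_nonneg_right (by positivity))
    · have := NNReal.coe_le_coe.2 (key w z hwz)
      rw [NNReal.coe_add, NNReal.coe_mul, NNReal.coe_sub hwz] at this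
      refine this.trans ?_
      gcongr
      rw [NNReal.dist_eq]
      exact le_abs_self _
  exact this

theorem continuous_bellmanSum [TopologicalSpace Θ] (h : IsValue p₀ p₁ c₀ c₁ l₀ l₁ ρ)
    (hρ : IsSubhomogeneous ρ) (hp₀ : ∀ k, Continuous fun θ => p₀ θ k)
    (hp₁ : ∀ k, Continuous fun θ => p₁ θ k) (z : ℝ≥0) :
    Continuous fun θ => bellmanSum p₀ p₁ ρ z θ := by
  have hcont : Continuous ρ := (h.lipschitzWith hρ).continuous
  refine continuous_finsetSum _ fun k _ => continuous_iff_continuousAt.2 fun θ => ?_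
  by_cases h0 : p₀ θ k = 0
  -- Where `p₀ θ k` vanishes the likelihood ratio may be discontinuous, but boundedness of `ρ`
  -- squeezes the summand to zero.
  · have hlim : Filter.Tendsto (fun θ' => p₀ θ' k * l₀) (nhds θ) (nhds 0) := by
      have := ((hp₀ k).mul_const l₀).tendsto θ
      rwa [h0, zero_mul] at this
    rw [ContinuousAt, h0, zero_mul]
    exact tendsto_of_tendsto_of_tendsto_of_le_of_le tendsto_const_nhds hlim
      (fun _ => zero_le) fun θ' => mul_le_mul_right (h.le_left _) _
  · exact (hp₀ k).continuousAt.mul (hcont.continuousAt.comp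
      (continuousAt_const.mul ((hp₁ k).continuousAt.div₀ (hp₀ k).continuousAt h0)))

end Thresholds

/-! ### The cost of a test as a sum over histories -/

section Histories

open unitInterval

variable {Θ : Type*} {K : ℕ}

/-- The probability of a history when the output probabilities are `p`. -/
noncomputable def histProb (p : Θ → Fin K → ℝ≥0) (η : QuantRule K Θ) :
    (n : ℕ) → (Fin n → Fin K) → ℝ≥0
  | 0, _ => 1
  | n + 1, y => histProb p η n (Fin.init y) * p (η n (Fin.init y)) (y (Fin.last n))

/-- The conditional probability given the history that the test has not stopped before time `n`. -/
noncomputable def survProb (ψ : TestRule K) : (n : ℕ) → (Fin n → Fin K) → ℝ≥0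
  | 0, _ => 1
  | n + 1, y => survProb ψ n (Fin.init y) * toNNReal (σ (ψ n (Fin.init y)))

/-- The expected cost incurred at time `n`. -/
noncomputable def stepCost (p₀ p₁ : Θ → Fin K → ℝ≥0) (c₀ c₁ l₀ l₁ : ℝ≥0) (η : QuantRule K Θ)
    (δ ψ : TestRule K) (n : ℕ) : ℝ≥0 :=
  ∑ y : Fin n → Fin K, survProb ψ n y *
    (toNNReal (σ (ψ n y)) * (c₀ * histProb p₀ η n y + c₁ * histProb p₁ η n y) +
      toNNReal (ψ n y) * (toNNReal (δ n y) * (histProb p₀ η n y * l₀) +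
        toNNReal (σ (δ n y)) * (histProb p₁ η n y * l₁)))

/-- The homogeneous extension of `ρ` to pairs of probabilities. -/
noncomputable def pairValue (ρ : ℝ≥0 → ℝ≥0) (a b : ℝ≥0) : ℝ≥0 := a * ρ (b / a)

/-- The expected optimal cost from time `n` on. -/
noncomputable def residual (p₀ p₁ : Θ → Fin K → ℝ≥0) (ρ : ℝ≥0 → ℝ≥0) (η : QuantRule K Θ)
    (ψ : TestRule K) (n : ℕ) : ℝ≥0 :=
  ∑ y : Fin n → Fin K, survProb ψ n y * pairValue ρ (histProb p₀ η n y) (histProb p₁ η n y)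

theorem sum_snoc {M : Type*} [AddCommMonoid M] (n : ℕ) (f : (Fin (n + 1) → Fin K) → M) :
    ∑ y, f y = ∑ y : Fin n → Fin K, ∑ k, f (Fin.snoc (α := fun _ => Fin K) y k) := by
  rw [← (Fin.snocEquiv fun _ : Fin (n + 1) => Fin K).sum_comp, Fintype.sum_prod_type_right]
  rfl

variable {p₀ p₁ : Θ → Fin K → ℝ≥0} {c₀ c₁ l₀ l₁ : ℝ≥0} {ρ : ℝ≥0 → ℝ≥0}
  {η : QuantRule K Θ} {δ ψ : TestRule K}

@[simp]
theorem histProb_snoc (p : Θ → Fin K → ℝ≥0) (n : ℕ) (y : Fin n → Fin K) (k : Fin K) :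
    histProb p η (n + 1) (Fin.snoc (α := fun _ => Fin K) y k) =
      histProb p η n y * p (η n y) k := by
  simp [histProb]

@[simp]
theorem survProb_snoc (n : ℕ) (y : Fin n → Fin K) (k : Fin K) :
    survProb ψ (n + 1) (Fin.snoc (α := fun _ => Fin K) y k) =
      survProb ψ n y * toNNReal (σ (ψ n y)) := by
  simp [survProb]

theorem sum_histProb {p : Θ → Fin K → ℝ≥0} (hp : ∀ θ, ∑ k, p θ k = 1) (n : ℕ) :
    ∑ y, histProb p η n y = 1 := by
  induction n with
  | zero => simp [histProb]
  | succ n ih => simp [sum_snoc, ← Finset.mul_sum, hp, ih]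

theorem survProb_le_one (n : ℕ) (y : Fin n → Fin K) : survProb ψ n y ≤ 1 := by
  induction n with
  | zero => exact le_rfl
  | succ n ih => exact mul_le_one' (ih _) (σ (ψ n (Fin.init y))).2.2

theorem residual_zero : residual p₀ p₁ ρ η ψ 0 = ρ 1 := by
  simp [residual, survProb, histProb, pairValue]

theorem residual_succ (n : ℕ) :
    residual p₀ p₁ ρ η ψ (n + 1) = ∑ y : Fin n → Fin K, survProb ψ n y *
      (toNNReal (σ (ψ n y)) * ∑ k, pairValue ρ (histProb p₀ η n y * p₀ (η n y) k)
        (histProb p₁ η n y * p₁ (η n y) k)) := by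
  simp [residual, sum_snoc, Finset.mul_sum, mul_assoc]

theorem sum_pairValue (a b : ℝ≥0) (θ : Θ) :
    ∑ k, pairValue ρ (a * p₀ θ k) (b * p₁ θ k) = a * bellmanSum p₀ p₁ ρ (b / a) θ := by
  simp only [pairValue, bellmanSum, Finset.mul_sum, mul_div_mul_comm, mul_assoc]

/-- Strict for `a = 0 < b`, where the quotient is the default `0`. The lower bound on the cost needs
only this direction. -/
theorem mul_div_le_self (a b : ℝ≥0) : a * (b / a) ≤ b := by
  rw [mul_comm]
  rcases eq_or_ne a 0 with rfl | ha
  · simp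
  · rw [div_mul_cancel₀ _ ha]

theorem IsValue.pairValue_le_left (h : IsValue p₀ p₁ c₀ c₁ l₀ l₁ ρ) (a b : ℝ≥0) :
    pairValue ρ a b ≤ a * l₀ :=
  mul_le_mul_right (h.le_left _) _

theorem IsValue.pairValue_le_right (h : IsValue p₀ p₁ c₀ c₁ l₀ l₁ ρ) (a b : ℝ≥0) :
    pairValue ρ a b ≤ b * l₁ :=
  calc pairValue ρ a b ≤ a * (b / a * l₁) := mul_le_mul_right (h.le_mul _) _
    _ = a * (b / a) * l₁ := (mul_assoc _ _ _).symm
    _ ≤ b * l₁ := by gcongr; exact mul_div_le_self _ _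

theorem IsValue.pairValue_le_continue (h : IsValue p₀ p₁ c₀ c₁ l₀ l₁ ρ) (a b : ℝ≥0)
    (θ : Θ) :
    pairValue ρ a b ≤ c₀ * a + c₁ * b + ∑ k, pairValue ρ (a * p₀ θ k) (b * p₁ θ k) := by
  rw [sum_pairValue]
  calc pairValue ρ a b ≤ a * (c₀ + c₁ * (b / a) + bellmanSum p₀ p₁ ρ (b / a) θ) := by
        refine mul_le_mul_right ((h.le_continuation _).trans ?_) _
        exact add_le_add_right (ciInf_le (OrderBot.bddBelow _) θ) _
    _ = c₀ * a + c₁ * (a * (b / a)) + a * bellmanSum p₀ p₁ ρ (b / a) θ := by ring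
    _ ≤ _ := by gcongr; exact mul_div_le_self _ _

theorem le_convexCombination (t : I) {x u v : ℝ≥0} (hu : x ≤ u) (hv : x ≤ v) :
    x ≤ toNNReal t * u + toNNReal (σ t) * v :=
  calc x = toNNReal t * x + toNNReal (σ t) * x := by
        rw [← add_mul, toNNReal_add_toNNReal_symm, one_mul]
    _ ≤ _ := by gcongr

/-- Randomization does not help: the optimal value is below each of the three actions, hence below
any convex combination of them. -/
theorem IsValue.residual_le (h : IsValue p₀ p₁ c₀ c₁ l₀ l₁ ρ) (n : ℕ) :
    residual p₀ p₁ ρ η ψ n ≤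
      stepCost p₀ p₁ c₀ c₁ l₀ l₁ η δ ψ n + residual p₀ p₁ ρ η ψ (n + 1) := by
  rw [residual_succ, stepCost, residual, ← Finset.sum_add_distrib]
  refine Finset.sum_le_sum fun y _ => ?_
  rw [← mul_add]
  gcongr
  refine (le_convexCombination (ψ n y)
    (le_convexCombination (δ n y) (h.pairValue_le_left _ _) (h.pairValue_le_right _ _))
    (h.pairValue_le_continue _ _ (η n y))).trans_eq ?_
  ring

/-- Stopping pays a decision cost at least the remaining value, and continuing pays a running cost
comparable with it. This makes the remainder vanish without assuming that the test stops. -/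
theorem IsValue.residual_le_mul (h : IsValue p₀ p₁ c₀ c₁ l₀ l₁ ρ) (hc : c₀ + c₁ = 1) (n : ℕ) :
    residual p₀ p₁ ρ η ψ n ≤ (1 + l₀ + l₁) * stepCost p₀ p₁ c₀ c₁ l₀ l₁ η δ ψ n := by
  have h1 : ∀ x : ℝ≥0, x ≤ (1 + l₀ + l₁) * x := fun x =>
    le_mul_of_one_le_left' (by rw [add_assoc]; exact le_self_add)
  rw [residual, stepCost, Finset.mul_sum]
  refine Finset.sum_le_sum fun y _ => ?_
  rw [mul_left_comm]
  gcongr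
  set a := histProb p₀ η n y
  set b := histProb p₁ η n y
  have hcont : pairValue ρ a b ≤ (1 + l₀ + l₁) * (c₀ * a + c₁ * b) :=
    (le_min (h.pairValue_le_left a b) (h.pairValue_le_right a b)).trans
      (min_mul_le_of_add_eq_one hc a b)
  refine (le_convexCombination (ψ n y)
    ((le_convexCombination (δ n y) (h.pairValue_le_left _ _) (h.pairValue_le_right _ _)).trans
      (h1 _)) hcont).trans_eq ?_
  ring

/-- No test has a smaller cost than the value function. -/
theorem IsValue.le_tsum_stepCost (h : IsValue p₀ p₁ c₀ c₁ l₀ l₁ ρ) (hc : c₀ + c₁ = 1) :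
    (ρ 1 : ℝ≥0∞) ≤ ∑' n, (stepCost p₀ p₁ c₀ c₁ l₀ l₁ η δ ψ n : ℝ≥0∞) := by
  set s := stepCost p₀ p₁ c₀ c₁ l₀ l₁ η δ ψ with hs
  by_cases htop : ∑' n, (s n : ℝ≥0∞) = ⊤
  · rw [htop]
    exact le_top
  have hpartial : ∀ n, ρ 1 ≤ ∑ m ∈ Finset.range n, s m + residual p₀ p₁ ρ η ψ n := by
    intro n
    induction n with
    | zero => simp [residual_zero]
    | succ n ih =>
      rw [Finset.sum_range_succ, add_assoc]
      exact ih.trans (add_le_add_right (h.residual_le n) _)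
  have hbound : ∀ n, (ρ 1 : ℝ≥0∞) ≤
      ∑' n, (s n : ℝ≥0∞) + ((1 + l₀ + l₁ : ℝ≥0) : ℝ≥0∞) * s n := fun n => by
    have := (hpartial n).trans (add_le_add_right (h.residual_le_mul (δ := δ) hc n) _)
    rw [← hs, ← ENNReal.coe_le_coe] at this
    refine this.trans ?_
    rw [ENNReal.coe_add, ENNReal.coe_mul, ENNReal.ofNNReal_finsetSum]
    gcongr
    exact ENNReal.sum_le_tsum _
  have hlim : Filter.Tendsto
      (fun n => ∑' n, (s n : ℝ≥0∞) + ((1 + l₀ + l₁ : ℝ≥0) : ℝ≥0∞) * s n) Filter.atTop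
      (nhds (∑' n, (s n : ℝ≥0∞) + ((1 + l₀ + l₁ : ℝ≥0) : ℝ≥0∞) * 0)) :=
    (ENNReal.Tendsto.const_mul (ENNReal.tendsto_atTop_zero_of_tsum_ne_top htop)
      (Or.inr ENNReal.coe_ne_top)).const_add _
  rw [mul_zero, add_zero] at hlim
  exact ge_of_tendsto' hlim hbound

/-- A test whose steps are optimal up to the errors `ε n` is optimal up to the sum of the errors. -/
theorem tsum_stepCost_le {ε : ℕ → ℝ≥0} (hp₀ : ∀ θ, ∑ k, p₀ θ k = 1)
    (hstep : ∀ n y, toNNReal (σ (ψ n y)) * (c₀ * histProb p₀ η n y + c₁ * histProb p₁ η n y) +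
      toNNReal (ψ n y) * (toNNReal (δ n y) * (histProb p₀ η n y * l₀) +
        toNNReal (σ (δ n y)) * (histProb p₁ η n y * l₁)) +
      toNNReal (σ (ψ n y)) * (histProb p₀ η n y *
        bellmanSum p₀ p₁ ρ (histProb p₁ η n y / histProb p₀ η n y) (η n y)) ≤
      pairValue ρ (histProb p₀ η n y) (histProb p₁ η n y) + histProb p₀ η n y * ε n) :
    ∑' n, (stepCost p₀ p₁ c₀ c₁ l₀ l₁ η δ ψ n : ℝ≥0∞) ≤ ρ 1 + ∑' n, (ε n : ℝ≥0∞) := by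
  set s := stepCost p₀ p₁ c₀ c₁ l₀ l₁ η δ ψ with hs
  have hone : ∀ n, s n + residual p₀ p₁ ρ η ψ (n + 1) ≤ residual p₀ p₁ ρ η ψ n + ε n := fun n => by
    -- The errors are weighted by a probability distribution on histories, so step `n` loses at most
    -- `ε n`.
    have hε : ε n = ∑ y, histProb p₀ η n y * ε n := by
      rw [← Finset.sum_mul, sum_histProb hp₀, one_mul]
    rw [hs, stepCost, residual_succ, residual, hε, ← Finset.sum_add_distrib,
      ← Finset.sum_add_distrib]
    refine Finset.sum_le_sum fun y _ => ?_
    rw [← mul_add, sum_pairValue]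
    refine (mul_le_mul_right (hstep n y) _).trans ?_
    rw [mul_add]
    exact add_le_add_right (mul_le_of_le_one_left' (survProb_le_one n y)) _
  have hpartial : ∀ n, ∑ m ∈ Finset.range n, s m + residual p₀ p₁ ρ η ψ n ≤
      ρ 1 + ∑ m ∈ Finset.range n, ε m := by
    intro n
    induction n with
    | zero => simp [residual_zero]
    | succ n ih =>
      rw [Finset.sum_range_succ, Finset.sum_range_succ, add_assoc, ← add_assoc (ρ 1)]
      refine (add_le_add_right (hone n) _).trans ?_
      rw [← add_assoc]
      exact add_le_add_left ih _
  rw [ENNReal.tsum_eq_iSup_nat]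
  refine iSup_le fun n => ?_
  rw [← ENNReal.ofNNReal_finsetSum]
  refine (ENNReal.coe_le_coe.2 (le_self_add.trans (hpartial n))).trans ?_
  rw [ENNReal.coe_add, ENNReal.ofNNReal_finsetSum]
  gcongr
  exact ENNReal.sum_le_tsum _

end Histories

/-! ### The law of the observations and of the runs -/

section Laws

open unitInterval

theorem quantize_apply {𝒳 Θ : Type*} {K : ℕ} (q : Θ → 𝒳 → Fin K) (η : QuantRule K Θ) (x : ℕ → 𝒳) (n : ℕ) :
    quantize q η x n = q (η n (hist (quantize q η x) n)) (x n) := by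
  rw [quantize]
  rfl

variable {𝒳 Θ : Type*} [MeasurableSpace 𝒳] {K : ℕ}

theorem ofReal_coe (t : I) : ENNReal.ofReal t = (toNNReal t : ℝ≥0∞) :=
  ENNReal.ofReal_coe_nnreal (p := toNNReal t)

theorem ofReal_one_sub_coe (t : I) : ENNReal.ofReal (1 - t) = (toNNReal (σ t) : ℝ≥0∞) :=
  ENNReal.ofReal_coe_nnreal (p := toNNReal (σ t))

theorem hist_succ_eq_iff (y : ℕ → Fin K) (n : ℕ) (h : Fin (n + 1) → Fin K) :
    hist y (n + 1) = h ↔ hist y n = Fin.init h ∧ y n = h (Fin.last n) := by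
  simp only [funext_iff, Fin.forall_fin_succ']
  rfl

theorem measurable_hist (n : ℕ) : Measurable fun y : ℕ → Fin K => hist y n :=
  measurable_pi_lambda _ fun i => measurable_pi_apply (i : ℕ)

theorem measurableSet_hist_eq (n : ℕ) (h : Fin n → Fin K) :
    MeasurableSet {y : ℕ → Fin K | hist y n = h} :=
  measurable_hist n (measurableSet_singleton h)

theorem measurable_quantize {q : Θ → 𝒳 → Fin K} (hq : ∀ θ, Measurable (q θ))
    (η : QuantRule K Θ) : Measurable (quantize q η) := by
  refine measurable_pi_lambda _ fun n => ?_
  induction n using Nat.strong_induction_on with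
  | _ n ih =>
    have hhist : Measurable fun x => hist (quantize q η x) n :=
      measurable_pi_lambda _ fun i => ih i i.2
    refine measurable_to_countable' fun k => ?_
    have : (fun x => quantize q η x n) ⁻¹' {k} =
        ⋃ h : Fin n → Fin K, (fun x => hist (quantize q η x) n) ⁻¹' {h} ∩
          (fun x => x n) ⁻¹' (q (η n h) ⁻¹' {k}) := by
      ext x
      simp [quantize_apply q η x n]
    rw [this]
    exact MeasurableSet.iUnion fun h => (hhist (measurableSet_singleton h)).inter
      (measurable_pi_apply n (hq _ (measurableSet_singleton k)))

theorem coe_outProb (P : Measure 𝒳) [IsProbabilityMeasure P] {q : Θ → 𝒳 → Fin K}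
    (hq : ∀ θ, Measurable (q θ)) (θ : Θ) (k : Fin K) :
    (outProb P q θ k : ℝ≥0∞) = P (q θ ⁻¹' {k}) := by
  rw [outProb, Measure.map_apply (hq θ) (measurableSet_singleton k),
    ENNReal.coe_toNNReal (measure_ne_top _ _)]

theorem sum_outProb_filter (P : Measure 𝒳) [IsProbabilityMeasure P] {q : Θ → 𝒳 → Fin K}
    (hq : ∀ θ, Measurable (q θ)) (θ : Θ) (p : Fin K → Prop) [DecidablePred p] :
    ((∑ k with p k, outProb P q θ k : ℝ≥0) : ℝ≥0∞) = P (q θ ⁻¹' {k | p k}) := by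
  rw [ENNReal.ofNNReal_finsetSum]
  simp only [coe_outProb P hq]
  rw [sum_measure_preimage_singleton _ fun k _ => hq θ (measurableSet_singleton k)]
  simp

theorem sum_outProb (P : Measure 𝒳) [IsProbabilityMeasure P] {q : Θ → 𝒳 → Fin K}
    (hq : ∀ θ, Measurable (q θ)) (θ : Θ) : ∑ k, outProb P q θ k = 1 := by
  have := sum_outProb_filter P hq θ fun _ => True
  rw [Finset.filter_true, Set.ofPred_true, Set.preimage_univ, measure_univ] at this
  exact_mod_cast this

theorem pi_range_update {α : Type*} (n : ℕ) (t : ℕ → Set α) (s : Set α) :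
    Set.pi (Finset.range (n + 1) : Set ℕ) (Function.update t n s) =
      {x | x ∈ Set.pi (Finset.range n : Set ℕ) t ∧ x n ∈ s} := by
  ext x
  simp only [Set.mem_pi, Finset.coe_range, Set.mem_Iio, Set.mem_ofPred_eq]
  constructor
  · intro h
    refine ⟨fun i hi => ?_, by simpa using h n n.lt_succ_self⟩
    simpa [hi.ne] using h i (hi.trans n.lt_succ_self)
  · rintro ⟨h1, h2⟩ i hi
    rcases (Nat.lt_succ_iff_lt_or_eq.1 hi) with hi | rfl
    · simpa [hi.ne] using h1 i hi
    · simpa using h2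

theorem prod_range_update {α : Type*} {M : Type*} [CommMonoid M] (n : ℕ) (t : ℕ → Set α)
    (s : Set α) (f : Set α → M) :
    ∏ i ∈ Finset.range (n + 1), f (Function.update t n s i) =
      (∏ i ∈ Finset.range n, f (t i)) * f s := by
  rw [Finset.prod_range_succ, Function.update_self]
  congr 1
  refine Finset.prod_congr rfl fun i hi => ?_
  rw [Function.update_of_ne (Finset.mem_range.1 hi).ne]

theorem measurableSet_update {α : Type*} [MeasurableSpace α] {t : ℕ → Set α} {s : Set α}
    (ht : ∀ i, MeasurableSet (t i)) (hs : MeasurableSet s) (n i : ℕ) :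
    MeasurableSet (Function.update t n s i) := by
  rcases eq_or_ne i n with rfl | hi
  · rwa [Function.update_self]
  · rw [Function.update_of_ne hi]
    exact ht i

/-- Once the history is fixed, so are all quantizers used along it. The event is thus a
finite-dimensional box despite the feedback, and the product measure evaluates it. -/
theorem exists_box_hist (P : Measure 𝒳) [IsProbabilityMeasure P] {q : Θ → 𝒳 → Fin K}
    (hq : ∀ θ, Measurable (q θ)) (η : QuantRule K Θ) (n : ℕ) (h : Fin n → Fin K) :
    ∃ t : ℕ → Set 𝒳, (∀ i, MeasurableSet (t i)) ∧
      {x | hist (quantize q η x) n = h} = Set.pi (Finset.range n : Set ℕ) t ∧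
      (histProb (outProb P q) η n h : ℝ≥0∞) = ∏ i ∈ Finset.range n, P (t i) := by
  induction n with
  | zero =>
    refine ⟨fun _ => Set.univ, fun _ => MeasurableSet.univ, ?_, by simp [histProb]⟩
    ext x
    simp [Subsingleton.elim (hist (quantize q η x) 0) h]
  | succ n ih =>
    obtain ⟨t, ht, hset, hprob⟩ := ih (Fin.init h)
    have hs := hq (η n (Fin.init h)) (measurableSet_singleton (h (Fin.last n)))
    refine ⟨Function.update t n (q (η n (Fin.init h)) ⁻¹' {h (Fin.last n)}),
      measurableSet_update ht hs n, ?_, ?_⟩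
    · rw [pi_range_update, ← hset]
      ext x
      simp only [Set.mem_ofPred_eq, hist_succ_eq_iff, quantize_apply q η x n, Set.mem_preimage,
        Set.mem_singleton_iff]
      refine and_congr_right fun hx => ?_
      rw [hx]
    · rw [prod_range_update n t _ fun s => P s, ← hprob, histProb, ENNReal.coe_mul,
        coe_outProb P hq]

theorem obsLaw_hist (P : Measure 𝒳) [IsProbabilityMeasure P] {q : Θ → 𝒳 → Fin K}
    (hq : ∀ θ, Measurable (q θ)) (η : QuantRule K Θ) (n : ℕ) (h : Fin n → Fin K) :
    obsLaw P q η {y | hist y n = h} = histProb (outProb P q) η n h := by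
  obtain ⟨t, ht, hset, hprob⟩ := exists_box_hist P hq η n h
  rw [obsLaw, Measure.map_apply (measurable_quantize hq η) (measurableSet_hist_eq n h)]
  change Measure.infinitePi _ {x | hist (quantize q η x) n = h} = _
  rw [hset, Measure.infinitePi_pi _ fun i _ => ht i, hprob]

/-- The runs with history `h` at time `n` that have not stopped before time `n` and whose `n`-th
uniform variable is in `s`. -/
def runEvent (ψ : TestRule K) (n : ℕ) (h : Fin n → Fin K) (s : Set I) : Set (Run K) :=
  {ω | hist ω.1 n = h ∧ (∀ m < n, ψ m (hist ω.1 m) < ω.2 m) ∧ ω.2 n ∈ s}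

/-- The stopping probabilities before time `n` depend only on the fixed history, so survival
constrains each uniform variable separately. -/
theorem exists_box_surv (ψ : TestRule K) (n : ℕ) (h : Fin n → Fin K) :
    ∃ t : ℕ → Set I, (∀ i, MeasurableSet (t i)) ∧
      (∀ y : ℕ → Fin K, hist y n = h →
        {u : ℕ → I | ∀ m < n, ψ m (hist y m) < u m} = Set.pi (Finset.range n : Set ℕ) t) ∧
      (survProb ψ n h : ℝ≥0∞) = ∏ i ∈ Finset.range n, volume (t i) := by
  induction n with
  | zero =>
    refine ⟨fun _ => Set.univ, fun _ => MeasurableSet.univ, fun y _ => ?_, by simp [survProb]⟩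
    ext u
    simp
  | succ n ih =>
    obtain ⟨t, ht, hset, hprob⟩ := ih (Fin.init h)
    refine ⟨Function.update t n (Set.Ioi (ψ n (Fin.init h))),
      measurableSet_update ht measurableSet_Ioi n, fun y hy => ?_, ?_⟩
    · rw [hist_succ_eq_iff] at hy
      rw [pi_range_update, ← hset y hy.1, ← hy.1]
      ext u
      simp only [Set.mem_ofPred_eq, Set.mem_Ioi, Nat.lt_succ_iff_lt_or_eq, or_imp, forall_and,
        forall_eq]
    · rw [prod_range_update n t _ fun s => volume s, ← hprob, survProb, ENNReal.coe_mul,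
        unitInterval.volume_Ioi, ofReal_one_sub_coe]

theorem runEvent_eq_prod (ψ : TestRule K) (n : ℕ) (h : Fin n → Fin K) {s : Set I}
    (hs : MeasurableSet s) :
    ∃ t : ℕ → Set I, (∀ i, MeasurableSet (t i)) ∧
      runEvent ψ n h s = {y | hist y n = h} ×ˢ Set.pi (Finset.range (n + 1) : Set ℕ) t ∧
      survProb ψ n h * volume s = ∏ i ∈ Finset.range (n + 1), volume (t i) := by
  obtain ⟨t, ht, hset, hprob⟩ := exists_box_surv ψ n h
  refine ⟨Function.update t n s, measurableSet_update ht hs n, ?_, ?_⟩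
  · ext ω
    rw [pi_range_update]
    simp only [runEvent, Set.mem_ofPred_eq, Set.mem_prod]
    refine and_congr_right fun hω => ?_
    rw [← hset ω.1 hω]
    rfl
  · rw [prod_range_update n t _ fun s => volume s, ← hprob]

theorem measurableSet_runEvent (ψ : TestRule K) (n : ℕ) (h : Fin n → Fin K) {s : Set I}
    (hs : MeasurableSet s) : MeasurableSet (runEvent ψ n h s) := by
  obtain ⟨t, ht, hset, -⟩ := runEvent_eq_prod ψ n h hs
  rw [hset]
  exact (measurableSet_hist_eq n h).prod
    (MeasurableSet.pi (Finset.countable_toSet _) fun i _ => ht i)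

theorem runLaw_runEvent (Q : Measure (ℕ → Fin K)) (ψ : TestRule K) (n : ℕ) (h : Fin n → Fin K)
    {s : Set I} (hs : MeasurableSet s) :
    runLaw Q (runEvent ψ n h s) = Q {y | hist y n = h} * (survProb ψ n h * volume s) := by
  obtain ⟨t, ht, hset, hprob⟩ := runEvent_eq_prod ψ n h hs
  rw [hset, runLaw, Measure.prod_prod, hprob, Measure.infinitePi_pi _ fun i _ => ht i]

open Classical in
theorem sum_indicator_runEvent (ψ : TestRule K) (n : ℕ) (s : (Fin n → Fin K) → Set I)
    (F : (Fin n → Fin K) → ℝ≥0∞) (ω : Run K) :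
    ∑ h, (runEvent ψ n h (s h)).indicator (fun _ => F h) ω =
      if (∀ m < n, ψ m (hist ω.1 m) < ω.2 m) ∧ ω.2 n ∈ s (hist ω.1 n) then F (hist ω.1 n)
      else 0 := by
  rw [Finset.sum_eq_single (hist ω.1 n)]
  · simp only [runEvent, Set.indicator_apply, Set.mem_ofPred_eq, true_and]
  · intro h _ hne
    exact Set.indicator_of_notMem (fun hmem => hne hmem.1.symm) _
  · simp

theorem lintegral_tsum_runEvent (Q : Measure (ℕ → Fin K)) (ψ : TestRule K)
    {s : (n : ℕ) → (Fin n → Fin K) → Set I} (hs : ∀ n h, MeasurableSet (s n h))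
    (F : (n : ℕ) → (Fin n → Fin K) → ℝ≥0∞) :
    ∫⁻ ω, ∑' n, ∑ h, (runEvent ψ n h (s n h)).indicator (fun _ => F n h) ω ∂(runLaw Q) =
      ∑' n, ∑ h, F n h * (Q {y | hist y n = h} * (survProb ψ n h * volume (s n h))) := by
  have hmeas : ∀ n h, Measurable ((runEvent ψ n h (s n h)).indicator fun _ => F n h) :=
    fun n h => measurable_const.indicator (measurableSet_runEvent ψ n h (hs n h))
  rw [lintegral_tsum fun n => (Finset.measurable_sum _ fun h _ => hmeas n h).aemeasurable]
  refine tsum_congr fun n => ?_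
  rw [lintegral_finsetSum _ fun h _ => hmeas n h]
  refine Finset.sum_congr rfl fun h _ => ?_
  rw [lintegral_indicator_const (measurableSet_runEvent ψ n h (hs n h)),
    runLaw_runEvent Q ψ n h (hs n h)]

theorem le_stopTime_iff (ψ : TestRule K) (ω : Run K) (n : ℕ) :
    (n : ℕ∞) ≤ stopTime ψ ω ↔ ∀ m < n, ψ m (hist ω.1 m) < ω.2 m := by
  simp only [stopTime, le_iInf_iff, Nat.cast_le]
  exact forall_congr' fun m => by rw [← not_imp_not, not_le, not_le]

theorem lt_stopTime_iff (ψ : TestRule K) (ω : Run K) (n : ℕ) :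
    (n : ℕ∞) < stopTime ψ ω ↔
      (∀ m < n, ψ m (hist ω.1 m) < ω.2 m) ∧ ω.2 n ∈ Set.Ioi (ψ n (hist ω.1 n)) := by
  rw [← Order.add_one_le_iff_of_not_isMax (by simp), ← Nat.cast_succ, le_stopTime_iff]
  simp only [Nat.lt_succ_iff_lt_or_eq, or_imp, forall_and, forall_eq, Set.mem_Ioi]

theorem stopTime_eq_iff (ψ : TestRule K) (ω : Run K) (n : ℕ) :
    stopTime ψ ω = n ↔
      (∀ m < n, ψ m (hist ω.1 m) < ω.2 m) ∧ ω.2 n ∈ Set.Iic (ψ n (hist ω.1 n)) := by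
  rw [le_antisymm_iff, and_comm, le_stopTime_iff, ← not_lt, lt_stopTime_iff]
  simp only [Set.mem_Ioi, Set.mem_Iic, not_and, not_lt]
  exact ⟨fun h => ⟨h.1, h.2 h.1⟩, fun h => ⟨h.1, fun _ => h.2⟩⟩

open Classical in
theorem enat_toENNReal_eq_tsum (t : ℕ∞) :
    (t : ℝ≥0∞) = ∑' n : ℕ, if (n : ℕ∞) < t then 1 else 0 := by
  induction t using ENat.recTopCoe with
  | top => simp
  | coe N =>
    rw [tsum_eq_sum (s := Finset.range N)]
    · rw [Finset.sum_congr rfl fun n hn => if_pos (Nat.cast_lt.2 (Finset.mem_range.1 hn))]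
      simp
    · intro n hn
      rw [if_neg]
      simpa using hn

/-- The tail-sum formula: `τ` is the number of `n` with `n < τ`, and each such event splits over
histories. -/
theorem lintegral_stopTime (Q : Measure (ℕ → Fin K)) (ψ : TestRule K) :
    ∫⁻ ω, (stopTime ψ ω : ℝ≥0∞) ∂(runLaw Q) = ∑' n, ∑ h : Fin n → Fin K,
      Q {y | hist y n = h} * (survProb ψ n h * toNNReal (σ (ψ n h))) := by
  classical
  have hpt : ∀ ω, (stopTime ψ ω : ℝ≥0∞) = ∑' n, ∑ h : Fin n → Fin K,
      (runEvent ψ n h (Set.Ioi (ψ n h))).indicator (fun _ => 1) ω := fun ω => by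
    rw [enat_toENNReal_eq_tsum]
    refine tsum_congr fun n => ?_
    rw [sum_indicator_runEvent]
    exact if_congr (lt_stopTime_iff ψ ω n) rfl rfl
  simp only [hpt]
  rw [lintegral_tsum_runEvent Q ψ fun n h => measurableSet_Ioi]
  simp only [one_mul, unitInterval.volume_Ioi, ofReal_one_sub_coe]

theorem lintegral_stopValue (Q : Measure (ℕ → Fin K)) (ψ : TestRule K)
    (F : (n : ℕ) → (Fin n → Fin K) → ℝ≥0∞) :
    ∫⁻ ω, (if stopTime ψ ω = ⊤ then 0
        else F (stopTime ψ ω).toNat (hist ω.1 (stopTime ψ ω).toNat)) ∂(runLaw Q) =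
      ∑' n, ∑ h : Fin n → Fin K,
        F n h * (Q {y | hist y n = h} * (survProb ψ n h * toNNReal (ψ n h))) := by
  classical
  have hpt : ∀ ω, (if stopTime ψ ω = ⊤ then 0
      else F (stopTime ψ ω).toNat (hist ω.1 (stopTime ψ ω).toNat)) =
      ∑' n, ∑ h : Fin n → Fin K,
        (runEvent ψ n h (Set.Iic (ψ n h))).indicator (fun _ => F n h) ω := fun ω => by
    simp only [sum_indicator_runEvent, ← stopTime_eq_iff]
    generalize stopTime ψ ω = t
    induction t using ENat.recTopCoe with
    | top => simp
    | coe N =>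
      rw [tsum_eq_single N]
      · simp
      · intro n hn
        rw [if_neg]
        exact fun h => hn (Nat.cast_injective h).symm
  simp only [hpt]
  rw [lintegral_tsum_runEvent Q ψ fun n h => measurableSet_Iic]
  simp only [unitInterval.volume_Iic, ofReal_coe]

theorem cost_eq_tsum_stepCost (P₀ P₁ : Measure 𝒳) [IsProbabilityMeasure P₀]
    [IsProbabilityMeasure P₁] {q : Θ → 𝒳 → Fin K} (hq : ∀ θ, Measurable (q θ)) (κ l₀ l₁ : ℝ)
    (η : QuantRule K Θ) (δ ψ : TestRule K) :
    cost P₀ P₁ q κ l₀ l₁ η δ ψ =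
      ∑' n, (stepCost (outProb P₀ q) (outProb P₁ q) (1 - κ).toNNReal κ.toNNReal
        l₀.toNNReal l₁.toNNReal η δ ψ n : ℝ≥0∞) := by
  have h0 := lintegral_stopValue (obsLaw P₀ q η) ψ fun n h => ENNReal.ofReal (δ n h)
  have h1 := lintegral_stopValue (obsLaw P₁ q η) ψ fun n h => ENNReal.ofReal (1 - δ n h)
  simp only [cost, acceptOne, acceptZero]
  rw [h0, h1, lintegral_stopTime, ← ENNReal.tsum_mul_left, ← ENNReal.tsum_mul_left,
    ← ENNReal.tsum_add, ← ENNReal.tsum_add]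
  refine tsum_congr fun n => ?_
  rw [Finset.mul_sum, Finset.mul_sum, ← Finset.sum_add_distrib, ← Finset.sum_add_distrib,
    stepCost, ENNReal.ofNNReal_finsetSum]
  refine Finset.sum_congr rfl fun h _ => ?_
  rw [ofReal_coe, ofReal_one_sub_coe, mixLaw, Measure.add_apply, Measure.smul_apply, Measure.smul_apply,
    obsLaw_hist P₀ hq, obsLaw_hist P₁ hq]
  simp only [ENNReal.ofReal, smul_eq_mul]
  push_cast
  ring

end Laws

/-! ### Threshold tests -/

section ThresholdTests

open unitInterval

variable {𝒳 Θ : Type*} [MeasurableSpace 𝒳] {K : ℕ}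

/-- Holds without exception: inverses in `ℝ≥0∞` are multiplicative on finite factors, including
zeros. -/
theorem likRatio_eq_div (P₀ P₁ : Measure 𝒳) (q : Θ → 𝒳 → Fin K) (η : QuantRule K Θ) (n : ℕ)
    (y : Fin n → Fin K) :
    likRatio P₀ P₁ q η n y =
      (histProb (outProb P₁ q) η n y : ℝ≥0∞) / histProb (outProb P₀ q) η n y := by
  induction n with
  | zero => simp [likRatio, histProb]
  | succ n ih =>
    rw [likRatio, histProb, histProb, ih, ENNReal.coe_mul, ENNReal.coe_mul, div_eq_mul_inv,
      div_eq_mul_inv, div_eq_mul_inv,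
      ENNReal.mul_inv (Or.inr ENNReal.coe_ne_top) (Or.inl ENNReal.coe_ne_top)]
    exact mul_mul_mul_comm _ _ _ _

/-- The likelihood ratio when the quantization parameter at time `n` is `s n z`. -/
noncomputable def selectedRatio (P₀ P₁ : Measure 𝒳) (q : Θ → 𝒳 → Fin K) (s : ℕ → ℝ≥0 → Θ) :
    (n : ℕ) → (Fin n → Fin K) → ℝ≥0∞
  | 0, _ => 1
  | n + 1, y =>
      selectedRatio P₀ P₁ q s n (Fin.init y) *
        ((outProb P₁ q (s n (selectedRatio P₀ P₁ q s n (Fin.init y)).toNNReal)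
            (y (Fin.last n)) : ℝ≥0∞) /
          (outProb P₀ q (s n (selectedRatio P₀ P₁ q s n (Fin.init y)).toNNReal)
            (y (Fin.last n)) : ℝ≥0∞))

/-- The ratio depends on the rule and the rule on the ratio. Defining the ratio first, by recursion
on `n`, breaks the circle. -/
theorem exists_quantRule_eq (P₀ P₁ : Measure 𝒳) (q : Θ → 𝒳 → Fin K) (s : ℕ → ℝ≥0 → Θ) :
    ∃ η : QuantRule K Θ, ∀ n y, η n y = s n (likRatio P₀ P₁ q η n y).toNNReal := by
  set η : QuantRule K Θ := fun n y => s n (selectedRatio P₀ P₁ q s n y).toNNReal with hη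
  have h : ∀ n y, likRatio P₀ P₁ q η n y = selectedRatio P₀ P₁ q s n y := by
    intro n
    induction n with
    | zero => exact fun _ => rfl
    | succ n ih =>
      intro y
      rw [likRatio, selectedRatio, ih]
  exact ⟨η, fun n y => by rw [h]⟩

theorem thresholdStop_of_stop {P₀ P₁ : Measure 𝒳} {q : Θ → 𝒳 → Fin K} {η : QuantRule K Θ}
    {A : ℝ≥0∞} {B : ℝ≥0} {n : ℕ} {y : Fin n → Fin K}
    (h : A ≤ likRatio P₀ P₁ q η n y ∨ likRatio P₀ P₁ q η n y ≤ B) :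
    thresholdStop P₀ P₁ q η A B n y = 1 :=
  if_pos h

/-- Threshold tests with nearly optimal quantization rules are nearly optimal. -/
theorem cost_threshold_le {P₀ P₁ : Measure 𝒳} [IsProbabilityMeasure P₀]
    [IsProbabilityMeasure P₁] {q : Θ → 𝒳 → Fin K} (hq : ∀ θ, Measurable (q θ)) {κ l₀ l₁ : ℝ}
    {ρ : ℝ≥0 → ℝ≥0} (hρ : IsValue (outProb P₀ q) (outProb P₁ q) (1 - κ).toNNReal κ.toNNReal
      l₀.toNNReal l₁.toNNReal ρ) {A : ℝ≥0∞} {B : ℝ≥0}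
    (hA : ∀ z : ℝ≥0, A ≤ z → l₀.toNNReal ≤ z * l₁.toNNReal ∧ l₀.toNNReal ≤
      continuation (outProb P₀ q) (outProb P₁ q) (1 - κ).toNNReal κ.toNNReal ρ z)
    (hB : ∀ z ≤ B, z * l₁.toNNReal ≤ l₀.toNNReal ∧ z * l₁.toNNReal ≤
      continuation (outProb P₀ q) (outProb P₁ q) (1 - κ).toNNReal κ.toNNReal ρ z)
    (hAB : ∀ z : ℝ≥0, B < z → z < A →
      continuation (outProb P₀ q) (outProb P₁ q) (1 - κ).toNNReal κ.toNNReal ρ z ≤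
        min l₀.toNNReal (z * l₁.toNNReal))
    {η : QuantRule K Θ} {ε : ℕ → ℝ≥0}
    (hη : ∀ n y, likRatio P₀ P₁ q η n y ≠ ⊤ →
      bellmanSum (outProb P₀ q) (outProb P₁ q) ρ (likRatio P₀ P₁ q η n y).toNNReal (η n y) ≤
        (⨅ θ, bellmanSum (outProb P₀ q) (outProb P₁ q) ρ
          (likRatio P₀ P₁ q η n y).toNNReal θ) + ε n) :
    cost P₀ P₁ q κ l₀ l₁ η (thresholdDecide P₀ P₁ q η A) (thresholdStop P₀ P₁ q η A B) ≤
      ρ 1 + ∑' n, (ε n : ℝ≥0∞) := by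
  rw [cost_eq_tsum_stepCost P₀ P₁ hq]
  refine tsum_stepCost_le (sum_outProb P₀ hq) fun n y => ?_
  have hη' := hη n y
  set c₀ := (1 - κ).toNNReal
  set c₁ := κ.toNNReal
  set L₀ := l₀.toNNReal
  set L₁ := l₁.toNNReal
  set p₀ := outProb P₀ q
  set p₁ := outProb P₁ q
  set a := histProb p₀ η n y with ha
  set b := histProb p₁ η n y with hb
  have hL : likRatio P₀ P₁ q η n y = (b : ℝ≥0∞) / a := likRatio_eq_div P₀ P₁ q η n y
  have hdecide : A ≤ likRatio P₀ P₁ q η n y → thresholdStop P₀ P₁ q η A B n y = 1 ∧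
      thresholdDecide P₀ P₁ q η A n y = 1 := fun h => ⟨if_pos (Or.inl h), if_pos h⟩
  rcases eq_or_ne a 0 with h0 | h0
  · rcases eq_or_ne b 0 with h0' | h0'
    · simp [h0, h0']
    -- Such a history is possible only under the second hypothesis. The ratio is `⊤`, so the test
    -- decides correctly at no cost even if `A = ⊤`.
    · have htop : A ≤ likRatio P₀ P₁ q η n y := by
        rw [hL, h0, ENNReal.coe_zero, ENNReal.div_zero (by simpa using h0')]
        exact le_top
      simp [hdecide htop, h0]
  · have hz : likRatio P₀ P₁ q η n y = ((b / a : ℝ≥0) : ℝ≥0∞) := by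
      rw [hL, ENNReal.coe_div h0]
    have hbz : b = a * (b / a) := (mul_div_cancel₀ _ h0).symm
    rw [hz, ENNReal.toNNReal_coe] at hη'
    have hη'' := hη' ENNReal.coe_ne_top
    rw [pairValue]
    set z := b / a with hzdef
    rw [hz] at hdecide
    by_cases hAz : A ≤ z
    · have hval : ρ z = L₀ := by
        rw [hρ z, min_eq_left]
        exact le_min (hA z hAz).1 (hA z hAz).2
      simp [hdecide hAz, hval]
    · by_cases hBz : z ≤ B
      · have hval : ρ z = z * L₁ := by
          rw [hρ z, min_eq_right ((min_le_left _ _).trans (hB z hBz).1),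
            min_eq_left (hB z hBz).2]
        have h1 : thresholdStop P₀ P₁ q η A B n y = 1 :=
          if_pos (Or.inr (by rw [hz]; exact_mod_cast hBz))
        have h2 : thresholdDecide P₀ P₁ q η A n y = 0 := if_neg (by rwa [hz])
        have hle : b * L₁ ≤ a * (z * L₁) := by rw [← mul_assoc, ← hbz]
        simpa [h1, h2, hval] using hle.trans le_self_add
      · have hcont := hAB z (not_le.1 hBz) (not_le.1 hAz)
        have hval : ρ z = continuation p₀ p₁ c₀ c₁ ρ z := by
          rw [hρ z, ← min_assoc, min_eq_right hcont]
        have h1 : thresholdStop P₀ P₁ q η A B n y = 0 := if_neg (by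
          rw [hz, not_or]
          exact ⟨hAz, by exact_mod_cast hBz⟩)
        have hle : c₀ * a + c₁ * b + a * bellmanSum p₀ p₁ ρ z (η n y) ≤ a * ρ z + a * ε n := by
          calc c₀ * a + c₁ * b + a * bellmanSum p₀ p₁ ρ z (η n y)
              ≤ c₀ * a + c₁ * b + a * ((⨅ θ, bellmanSum p₀ p₁ ρ z θ) + ε n) := by gcongr
            _ = a * ρ z + a * ε n := by
                rw [hval, continuation]
                nth_rewrite 1 [hbz]
                ring
        simpa [h1] using hle

/-- The probability that the test has not stopped at time `n`. -/
noncomputable def contProb (p : Θ → Fin K → ℝ≥0) (η : QuantRule K Θ) (ψ : TestRule K) (n : ℕ) :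
    ℝ≥0 :=
  ∑ y : Fin n → Fin K, histProb p η n y * (survProb ψ n y * toNNReal (σ (ψ n y)))

/-- Never stopping implies `n < τ` for every `n`, an event of probability `contProb` at `n`. -/
theorem ae_stopTime_lt_top {P : Measure 𝒳} [IsProbabilityMeasure P] {q : Θ → 𝒳 → Fin K}
    (hq : ∀ θ, Measurable (q θ)) {η : QuantRule K Θ} {ψ : TestRule K}
    (h : Filter.Tendsto (contProb (outProb P q) η ψ) Filter.atTop (nhds 0)) :
    ∀ᵐ ω ∂(runLaw (obsLaw P q η)), stopTime ψ ω < ⊤ := by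
  have hle : ∀ n, runLaw (obsLaw P q η) {ω | ¬stopTime ψ ω < ⊤} ≤
      (contProb (outProb P q) η ψ n : ℝ≥0∞) := fun n => by
    have hsub : {ω | ¬stopTime ψ ω < ⊤} ⊆
        ⋃ y : Fin n → Fin K, runEvent ψ n y (Set.Ioi (ψ n y)) := fun ω hω => by
      have htop : stopTime ψ ω = ⊤ := not_lt_top_iff.1 hω
      have hlt := (lt_stopTime_iff ψ ω n).1 (by rw [htop]; exact ENat.natCast_lt_top n)
      exact Set.mem_iUnion.2 ⟨hist ω.1 n, rfl, hlt⟩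
    refine (measure_mono hsub).trans ((measure_iUnion_fintype_le _ _).trans_eq ?_)
    rw [contProb, ENNReal.ofNNReal_finsetSum]
    refine Finset.sum_congr rfl fun y _ => ?_
    rw [runLaw_runEvent _ _ _ _ measurableSet_Ioi, obsLaw_hist P hq, unitInterval.volume_Ioi,
      ofReal_one_sub_coe]
    push_cast
    rfl
  rw [ae_iff]
  have hlim : Filter.Tendsto (fun n => (contProb (outProb P q) η ψ n : ℝ≥0∞)) Filter.atTop
      (nhds ((0 : ℝ≥0) : ℝ≥0∞)) := ENNReal.tendsto_coe.2 h
  exact nonpos_iff_eq_zero.1 (ge_of_tendsto' hlim hle)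

theorem contProb_le_stepCost {p₀ p₁ : Θ → Fin K → ℝ≥0} {c₀ c₁ l₀ l₁ : ℝ≥0}
    {η : QuantRule K Θ} {δ ψ : TestRule K} (n : ℕ) :
    c₀ * contProb p₀ η ψ n + c₁ * contProb p₁ η ψ n ≤
      stepCost p₀ p₁ c₀ c₁ l₀ l₁ η δ ψ n := by
  rw [contProb, contProb, stepCost, Finset.mul_sum, Finset.mul_sum, ← Finset.sum_add_distrib]
  refine Finset.sum_le_sum fun y _ => ?_
  rw [mul_add]
  refine le_trans (le_of_eq ?_) le_self_add
  ring

theorem contProb_le_mul {P₀ P₁ : Measure 𝒳} {q : Θ → 𝒳 → Fin K} {η : QuantRule K Θ}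
    (A : ℝ≥0) (B : ℝ≥0) (n : ℕ) :
    contProb (outProb P₁ q) η (thresholdStop P₀ P₁ q η A B) n ≤
      A * contProb (outProb P₀ q) η (thresholdStop P₀ P₁ q η A B) n := by
  rw [contProb, contProb, Finset.mul_sum]
  refine Finset.sum_le_sum fun y _ => ?_
  by_cases h : (A : ℝ≥0∞) ≤ likRatio P₀ P₁ q η n y ∨ likRatio P₀ P₁ q η n y ≤ B
  · simp [thresholdStop_of_stop h]
  · rw [← mul_assoc A]
    gcongr
    rw [not_or, not_le, likRatio_eq_div] at h
    have := (ENNReal.div_le_iff_le_mul (Or.inr ENNReal.coe_ne_top)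
      (Or.inl ENNReal.coe_ne_top)).1 h.1.le
    exact_mod_cast this

theorem mul_contProb_le {P₀ P₁ : Measure 𝒳} {q : Θ → 𝒳 → Fin K} {η : QuantRule K Θ}
    (A : ℝ≥0∞) (B : ℝ≥0) (n : ℕ) :
    B * contProb (outProb P₀ q) η (thresholdStop P₀ P₁ q η A B) n ≤
      contProb (outProb P₁ q) η (thresholdStop P₀ P₁ q η A B) n := by
  rw [contProb, contProb, Finset.mul_sum]
  refine Finset.sum_le_sum fun y _ => ?_
  by_cases h : A ≤ likRatio P₀ P₁ q η n y ∨ likRatio P₀ P₁ q η n y ≤ B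
  · simp [thresholdStop_of_stop h]
  · rw [← mul_assoc]
    gcongr
    rw [not_or, not_le, not_le, likRatio_eq_div] at h
    have := ENNReal.mul_le_of_le_div h.2.le
    exact_mod_cast this

/-- A threshold test with finite positive thresholds and finite cost stops almost surely under both
hypotheses. -/
theorem ae_stopTime_threshold {P₀ P₁ : Measure 𝒳} [IsProbabilityMeasure P₀]
    [IsProbabilityMeasure P₁] {q : Θ → 𝒳 → Fin K} (hq : ∀ θ, Measurable (q θ)) {κ l₀ l₁ : ℝ}
    {η : QuantRule K Θ} {δ : TestRule K} {A : ℝ≥0∞} {B : ℝ≥0} (hA : A < ⊤) (hB : 0 < B)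
    (hc : (1 - κ).toNNReal + κ.toNNReal = 1)
    (hcost : cost P₀ P₁ q κ l₀ l₁ η δ (thresholdStop P₀ P₁ q η A B) ≠ ⊤) :
    (∀ᵐ ω ∂(runLaw (obsLaw P₀ q η)), stopTime (thresholdStop P₀ P₁ q η A B) ω < ⊤) ∧
      (∀ᵐ ω ∂(runLaw (obsLaw P₁ q η)), stopTime (thresholdStop P₀ P₁ q η A B) ω < ⊤) := by
  lift A to ℝ≥0 using hA.ne
  rw [cost_eq_tsum_stepCost P₀ P₁ hq] at hcost
  have hstep := ENNReal.tendsto_coe.1 (ENNReal.tendsto_atTop_zero_of_tsum_ne_top hcost)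
  set ψ := thresholdStop P₀ P₁ q η A B with hψ
  have hlim : Filter.Tendsto (fun n => (1 - κ).toNNReal * contProb (outProb P₀ q) η ψ n +
      κ.toNNReal * contProb (outProb P₁ q) η ψ n) Filter.atTop (nhds 0) :=
    tendsto_of_tendsto_of_tendsto_of_le_of_le tendsto_const_nhds hstep (fun _ => zero_le)
      fun n => contProb_le_stepCost n
  -- While the test continues, the ratio lies between `B` and `A`, so the two probabilities of
  -- continuing are comparable. This transfers the limit to a hypothesis that has weight zero in the
  -- running cost.
  have h10 : ∀ n, contProb (outProb P₁ q) η ψ n ≤ A * contProb (outProb P₀ q) η ψ n :=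
    contProb_le_mul A B
  have h01 : ∀ n, contProb (outProb P₀ q) η ψ n ≤ B⁻¹ * contProb (outProb P₁ q) η ψ n := fun n => by
    rw [le_inv_mul_iff₀ hB]
    exact mul_contProb_le A B n
  have hpos : ∀ {c : ℝ≥0} {f g : ℕ → ℝ≥0}, c ≠ 0 → (∀ n, c * f n ≤ g n) →
      Filter.Tendsto g Filter.atTop (nhds 0) → Filter.Tendsto f Filter.atTop (nhds 0) := by
    intro c f g hc0 hle hg
    have hg' := hg.const_mul c⁻¹
    rw [mul_zero] at hg'
    refine tendsto_of_tendsto_of_tendsto_of_le_of_le tendsto_const_nhds hg' (fun _ => zero_le)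
      fun n => ?_
    rw [le_inv_mul_iff₀ (pos_of_ne_zero hc0)]
    exact hle n
  have hmul : ∀ {c : ℝ≥0} {f g : ℕ → ℝ≥0}, (∀ n, f n ≤ c * g n) →
      Filter.Tendsto g Filter.atTop (nhds 0) → Filter.Tendsto f Filter.atTop (nhds 0) := by
    intro c f g hle hg
    have hg' := hg.const_mul c
    rw [mul_zero] at hg'
    exact tendsto_of_tendsto_of_tendsto_of_le_of_le tendsto_const_nhds hg' (fun _ => zero_le) hle
  by_cases hκ : κ.toNNReal = 0
  · have h0 := hpos (c := (1 - κ).toNNReal) (by simp [hκ] at hc; simp [hc])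
      (fun n => le_self_add) hlim
    exact ⟨ae_stopTime_lt_top hq h0, ae_stopTime_lt_top hq (hmul h10 h0)⟩
  · have h1 := hpos hκ (fun n => le_add_self) hlim
    exact ⟨ae_stopTime_lt_top hq (hmul h01 h1), ae_stopTime_lt_top hq h1⟩

end ThresholdTests

/-! ### The main theorem -/

section Main

variable {𝒳 Θ : Type*} [MeasurableSpace 𝒳] {K : ℕ}

theorem bellmanD_eq_bellmanSum (P₀ P₁ : Measure 𝒳) (q : Θ → 𝒳 → Fin K) (ρ : ℝ≥0 → ℝ≥0) (z : ℝ≥0)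
    (θ : Θ) :
    bellmanD P₀ P₁ q ρ z θ = bellmanSum (outProb P₀ q) (outProb P₁ q) ρ z θ := by
  rw [bellmanD, bellmanSum, NNReal.coe_sum, Finset.sum_filter]
  refine Finset.sum_congr rfl fun k _ => ?_
  split_ifs with h
  · rw [NNReal.coe_mul, mul_comm]
  · rw [not_lt, nonpos_iff_eq_zero] at h
    simp [h]

theorem isBellmanSolution_iff (P₀ P₁ : Measure 𝒳) (q : Θ → 𝒳 → Fin K) {κ l₀ l₁ : ℝ}
    (hκ₀ : 0 ≤ κ) (hκ₁ : κ ≤ 1) (hl₀ : 0 ≤ l₀) (hl₁ : 0 ≤ l₁) (ρ : ℝ≥0 → ℝ≥0) :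
    IsBellmanSolution P₀ P₁ q κ l₀ l₁ ρ ↔ IsValue (outProb P₀ q) (outProb P₁ q)
      (1 - κ).toNNReal κ.toNNReal l₀.toNNReal l₁.toNNReal ρ := by
  refine forall_congr' fun z => ?_
  simp only [bellmanD_eq_bellmanSum, continuation]
  rw [← NNReal.coe_inj]
  push_cast
  rw [Real.coe_toNNReal _ hl₀, Real.coe_toNNReal _ hl₁, Real.coe_toNNReal _ hκ₀,
    Real.coe_toNNReal _ (sub_nonneg.2 hκ₁)]

/-- The bad outputs have `P₁`-probability at most `r`. The ε-δ form of absolute continuity on the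
raw space, applied to their preimage, then makes the bound uniform in `θ`. -/
theorem exists_pos_sum_outProb_le {P₀ P₁ : Measure 𝒳} [IsProbabilityMeasure P₀]
    [IsProbabilityMeasure P₁] {q : Θ → 𝒳 → Fin K} (hq : ∀ θ, Measurable (q θ)) (hac : P₀ ≪ P₁)
    (ε : ℝ≥0) (hε : 0 < ε) :
    ∃ r : ℝ≥0, 0 < r ∧ ∀ θ,
      ∑ k with outProb P₁ q θ k < r * outProb P₀ q θ k, outProb P₀ q θ k ≤ ε := by
  have hfin : ∫⁻ x, P₀.rnDeriv P₁ x ∂P₁ ≠ ⊤ := (Measure.lintegral_rnDeriv_lt_top P₀ P₁).ne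
  obtain ⟨d, hd, hlt⟩ := exists_pos_setLIntegral_lt_of_measure_lt hfin
    (ENNReal.coe_ne_zero.2 hε.ne')
  obtain ⟨r, hr, hrd⟩ := ENNReal.lt_iff_exists_nnreal_btwn.1 hd
  refine ⟨r, ENNReal.coe_pos.1 hr, fun θ => ?_⟩
  set S := {k | outProb P₁ q θ k < r * outProb P₀ q θ k} with hS
  have hsmall : P₁ (q θ ⁻¹' S) < d := by
    refine lt_of_le_of_lt ?_ hrd
    rw [hS, ← sum_outProb_filter P₁ hq θ, ENNReal.coe_le_coe]
    calc ∑ k with outProb P₁ q θ k < r * outProb P₀ q θ k, outProb P₁ q θ k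
        ≤ ∑ k with outProb P₁ q θ k < r * outProb P₀ q θ k, r * outProb P₀ q θ k :=
          Finset.sum_le_sum fun k hk => (Finset.mem_filter.1 hk).2.le
      _ ≤ ∑ k, r * outProb P₀ q θ k :=
          Finset.sum_le_sum_of_subset (Finset.filter_subset _ _)
      _ = r := by rw [← Finset.mul_sum, sum_outProb P₀ hq, mul_one]
  have := hlt _ hsmall
  rw [Measure.setLIntegral_rnDeriv hac, hS, ← sum_outProb_filter P₀ hq θ] at this
  exact_mod_cast this.le

end Main

end QuantizedTest

open QuantizedTest
theorem proposition1 {𝒳 Θ : Type*} [MeasurableSpace 𝒳]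
    [TopologicalSpace Θ] [CompactSpace Θ] [Nonempty Θ] {K : ℕ}
    (P₀ P₁ : Measure 𝒳) [IsProbabilityMeasure P₀] [IsProbabilityMeasure P₁]
    (q : Θ → 𝒳 → Fin K) (hq : ∀ θ, Measurable (q θ))
    (κ l₀ l₁ : ℝ) (hκ₀ : 0 ≤ κ) (hκ₁ : κ ≤ 1) (hl₀ : 0 < l₀) (hl₁ : 0 < l₁) :
    ∃ ρ : ℝ≥0 → ℝ≥0,
      -- `ρ` is the unique solution of the functional equation
      IsBellmanSolution P₀ P₁ q κ l₀ l₁ ρ ∧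
      (∀ ρ' : ℝ≥0 → ℝ≥0, IsBellmanSolution P₀ P₁ q κ l₀ l₁ ρ' → ρ' = ρ) ∧
      -- its value at `1` is the optimal cost
      optCost P₀ P₁ q κ l₀ l₁ = (ρ 1 : ℝ≥0∞) ∧
      -- the minimum over `θ` is attained if the output probabilities are continuous in `θ`
      ((∀ k, Continuous fun θ => outProb P₀ q θ k) →
        (∀ k, Continuous fun θ => outProb P₁ q θ k) →
        ∃ s : ℝ≥0 → Θ, IsMinSelector P₀ P₁ q ρ s) ∧
      -- thresholds
      ∃ (A : ℝ≥0∞) (B : ℝ≥0), 0 < A ∧ (B : ℝ≥0∞) ≤ A ∧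
        (0 < κ ∨ P₀ ≪ P₁ → A < ⊤) ∧
        (κ < 1 ∨ P₁ ≪ P₀ → 0 < B) ∧
        -- for every minimizing selector `s`, the choice `θ_n = s z_n` can be made, and it is
        -- optimal, together with the two-threshold test on `z_n`
        ∀ s : ℝ≥0 → Θ, IsMinSelector P₀ P₁ q ρ s →
          (∃ η : QuantRule K Θ, Follows P₀ P₁ q s η) ∧
          ∀ η : QuantRule K Θ, Follows P₀ P₁ q s η →
            cost P₀ P₁ q κ l₀ l₁ η (thresholdDecide P₀ P₁ q η A)
                (thresholdStop P₀ P₁ q η A B) = optCost P₀ P₁ q κ l₀ l₁ ∧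
            -- unless a threshold is degenerate, this test stops almost surely
            (A < ⊤ → 0 < B →
              (∀ᵐ ω ∂(runLaw (obsLaw P₀ q η)), stopTime (thresholdStop P₀ P₁ q η A B) ω < ⊤) ∧
              (∀ᵐ ω ∂(runLaw (obsLaw P₁ q η)), stopTime (thresholdStop P₀ P₁ q η A B) ω < ⊤)) := by
  set c₀ := (1 - κ).toNNReal with hc₀
  set c₁ := κ.toNNReal with hc₁
  set L₀ := l₀.toNNReal with hL₀
  set L₁ := l₁.toNNReal with hL₁
  set p₀ := outProb P₀ q with hp₀
  set p₁ := outProb P₁ q with hp₁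
  have hc : c₀ + c₁ = 1 := by
    rw [hc₀, hc₁, ← Real.toNNReal_add (sub_nonneg.2 hκ₁) hκ₀, sub_add_cancel, Real.toNNReal_one]
  have hL₀pos : 0 < L₀ := Real.toNNReal_pos.2 hl₀
  have hL₁pos : 0 < L₁ := Real.toNNReal_pos.2 hl₁
  obtain ⟨ρ, hρ, hsub⟩ := exists_isValue p₀ p₁ c₀ c₁ L₀ L₁
  have hiff := isBellmanSolution_iff P₀ P₁ q hκ₀ hκ₁ hl₀.le hl₁.le
  obtain ⟨A, B, hApos, hBA, hAtop, hBpos, hA, hB, hAB⟩ :=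
    exists_thresholds (hsub.continuation (p₀ := p₀) (p₁ := p₁) (c₀ := c₀) (c₁ := c₁)) hL₀pos hL₁pos
  have hlower : (ρ 1 : ℝ≥0∞) ≤ optCost P₀ P₁ q κ l₀ l₁ := by
    refine le_iInf fun η => le_iInf fun δ => le_iInf fun ψ => ?_
    rw [cost_eq_tsum_stepCost P₀ P₁ hq]
    exact hρ.le_tsum_stepCost hc
  have hopt : optCost P₀ P₁ q κ l₀ l₁ = ρ 1 := by
    refine le_antisymm (ENNReal.le_of_forall_pos_le_add fun ε hε _ => ?_) hlower
    obtain ⟨e, he, hsum⟩ :=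
      ENNReal.exists_pos_sum_of_countable (ENNReal.coe_ne_zero.2 hε.ne') ℕ
    -- Nearly minimizing selectors always exist; they vary with `n` so that their errors are
    -- summable.
    have hsel : ∀ (n : ℕ) (z : ℝ≥0), ∃ θ,
        bellmanSum p₀ p₁ ρ z θ < (⨅ θ, bellmanSum p₀ p₁ ρ z θ) + e n := fun n z =>
      exists_lt_of_ciInf_lt (lt_add_of_pos_right _ (he n))
    choose s hs using hsel
    obtain ⟨η, hη⟩ := exists_quantRule_eq P₀ P₁ q s
    refine (iInf_le_of_le η (iInf₂_le _ _)).trans ((cost_threshold_le hq hρ hA hB hAB (η := η)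
      (ε := e) fun n y _ => ?_).trans (by gcongr))
    conv_lhs => rw [hη]
    exact (hs n _).le
  refine ⟨ρ, (hiff ρ).2 hρ, fun ρ' hρ' => ((hiff ρ').1 hρ').unique hc hρ, hopt,
    fun h0 h1 => ?_, A, B, hApos, hBA, fun h => ?_, fun h => ?_, fun s hs => ⟨?_, fun η hη => ?_⟩⟩
  · have hmin : ∀ z, ∃ θ, ∀ θ', bellmanSum p₀ p₁ ρ z θ ≤ bellmanSum p₀ p₁ ρ z θ' := fun z => by
      obtain ⟨θ, -, hθ⟩ := isCompact_univ.exists_isMinOn Set.univ_nonempty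
        (continuous_bellmanSum hρ hsub h0 h1 z).continuousOn
      exact ⟨θ, fun θ' => hθ (Set.mem_univ θ')⟩
    choose s hs using hmin
    refine ⟨s, fun z θ => ?_⟩
    rw [bellmanD_eq_bellmanSum, bellmanD_eq_bellmanSum]
    exact_mod_cast hs z θ
  · have hz : ∃ z, L₀ ≤ z * L₁ ∧ L₀ ≤ continuation p₀ p₁ c₀ c₁ ρ z := by
      rcases hκ₀.eq_or_lt with h0 | h0
      · refine exists_le_continuation hρ hsub (sum_outProb P₀ hq) ?_ hL₀pos hL₁pos
          (exists_pos_sum_outProb_le hq (h.resolve_left h0.not_lt))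
        rw [hc₀, ← h0]
        simp
      · exact exists_le_continuation_of_pos (Real.toNNReal_pos.2 h0) hL₁pos
    obtain ⟨z, h1, h2⟩ := hz
    exact hAtop z h1 h2
  · have hz : ∃ z, 0 < z ∧ z * L₁ ≤ L₀ ∧ z * L₁ ≤ continuation p₀ p₁ c₀ c₁ ρ z := by
      rcases hκ₁.eq_or_lt with h0 | h0
      · refine exists_mul_le_continuation hρ hsub (sum_outProb P₁ hq) ?_ hL₀pos hL₁pos
          (exists_pos_sum_outProb_le hq (h.resolve_left h0.not_lt))
        rw [hc₁, h0]
        simp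
      · exact exists_mul_le_continuation_of_pos (Real.toNNReal_pos.2 (sub_pos.2 h0)) hL₀pos hL₁pos
    obtain ⟨z, h0, h1, h2⟩ := hz
    exact hBpos z h0 h1 h2
  · obtain ⟨η, hη⟩ := exists_quantRule_eq P₀ P₁ q fun _ => s
    exact ⟨η, fun n y _ => hη n y⟩
  · have hcost : cost P₀ P₁ q κ l₀ l₁ η (thresholdDecide P₀ P₁ q η A)
        (thresholdStop P₀ P₁ q η A B) = optCost P₀ P₁ q κ l₀ l₁ := by
      refine le_antisymm ?_ (iInf_le_of_le η (iInf₂_le _ _))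
      rw [hopt]
      refine (cost_threshold_le hq hρ hA hB hAB (ε := 0) fun n y hy => ?_).trans_eq (by simp)
      rw [Pi.zero_apply, add_zero, hη n y hy]
      refine le_ciInf fun θ => ?_
      have := hs (likRatio P₀ P₁ q η n y).toNNReal θ
      rw [bellmanD_eq_bellmanSum, bellmanD_eq_bellmanSum] at this
      exact_mod_cast this
    have hfin : cost P₀ P₁ q κ l₀ l₁ η (thresholdDecide P₀ P₁ q η A)
        (thresholdStop P₀ P₁ q η A B) ≠ ⊤ := by
      rw [hcost, hopt]
      exact ENNReal.coe_ne_top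
    exact ⟨hcost, fun hAlt hBlt => ae_stopTime_threshold hq hAlt hBlt hc hfin⟩
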